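/- Let $\mathcal X$ be a Polish space and let $(\Omega,\mathcal F,(\mathcal F_t)_{t\ge 0})$ be a filtered measurable space carrying an adapted, càdlàg, $\mathcal X$-valued process $(X_t)_{t\ge0}$. Let $P^x$, $x\in\mathcal X$, be probability measures on $(\Omega,\mathcal F)$ such that $X_0$ has law $\delta_x$ under $P^x$, $x\mapsto P^x(F)$ is universally measurable for every $F\in\mathcal F$, and $(X_t,P^x)$ is a time-homogeneous Markov family with transition probabilities $p_t(x,dy)$, i.e. $P^x(X_{t+s}\in B\mid\mathcal F_s)=p_t(X_s,B)$ $P^x$-a.s. for all $x$, $s,t\ge0$ and Borel $B$. Let $\widetilde P^x$, $x\in\mathcal X$, be a second family of probability measures on $(\Omega,\mathcal F)$ such that $X_0$ has law $\delta_x$ under $\widetilde P^x$ and $x\mapsto\widetilde P^x(F)$ is universally measurable for every $F\in\mathcal F$ (no Markov property is assumed). For probability measures $\mu,\widetilde\mu$ on $\mathcal X$ put $P^\mu=\int P^x\,\mu(dx)$ and $\widetilde P^{\widetilde\mu}=\int\widetilde P^x\,\widetilde\mu(dx)$, write $\widetilde E^{\widetilde\mu}$ for the expectation under $\widetilde P^{\widetilde\mu}$,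 and for $T>0$ let $P^\mu_T,\widetilde P^{\widetilde\mu}_T$ be the restrictions of these measures to $\mathcal F_T$. Let $\mu^*$ be an invariant probability measure for $p_t$, and let $(A,D(A))$ be the generator on $L^2(\mu^*)$ of the strongly continuous semigroup $\mathcal P_t[g](x)=\int g(y)\,p_t(x,dy)$: $g\in D(A)$ and $A[g]=h$ iff $(\mathcal P_t[g]-g)/t\to h$ in $L^2(\mu^*)$ as $t\searrow0$. Let $D(A,\mathbb R)$ be the set of real-valued functions in $D(A)$, and for bounded measurable $V:\mathcal X\to\mathbb R$ let $$\kappa(V)=\sup\Big\{\langle A[g],g\rangle_{L^2(\mu^*)}+\int V g^2\,d\mu^*\;:\;g\in D(A,\mathbb R),\ \|g\|_{L^2(\mu^*)}=1\Big\}.$$ Then for every bounded measurable $f:\mathcal X\to\mathbb R$, every probability measure $\widetilde\mu$ on $\mathcal X$ and every $T>0$, for both choices of the sign, $$\pm\left(\widetilde E^{\widetilde\mu}\left[\frac1T\int_0^T f(X_t)\,dt\right]-\mu^*[f]\right)\le\inf_{c>0}\left\{\frac{\kappa(V_{\pm c})+\eta}{c}\right\},$$ where $\mu^*[f]=\int f\,d\mu^*$,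 $V_{\pm c}=\pm c\,(f-\mu^*[f])$, $\eta=\frac1T R(\widetilde P^{\widetilde\mu}_T\,\|\,P^{\mu^*}_T)\in[0,\infty]$, and $R(Q\|P)$ denotes the relative entropy, equal to $E_Q[\log(dQ/dP)]$ if $Q\ll P$ and to $+\infty$ otherwise. (If $\eta=\infty$, the right-hand side is $+\infty$.) -/

import Mathlib

open MeasureTheory Filter Topology
open scoped NNReal ENNReal

/-- A function is universally measurable if it is measurable with respect to the completion of the
Borel `σ`-algebra under every probability measure. -/
def UniversallyMeasurable {E : Type*} [MeasurableSpace E] (g : E → ℝ≥0∞) : Prop :=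
  ∀ ν : Measure E, IsProbabilityMeasure ν → NullMeasurable g ν

/-- A path with values in `E` is càdlàg: right continuous, with left limits. The existence of a
left limit at time `0` is an empty requirement. -/
def IsCadlag {E : Type*} [TopologicalSpace E] (w : ℝ≥0 → E) : Prop :=
  ∀ t, ContinuousWithinAt w (Set.Ici t) t ∧ ∃ l, Tendsto w (𝓝[<] t) (𝓝 l)

/-- A family `P x`, `x : E`, of probability measures on `Ω` under which `X₀` starts at `x`,
depending on `x` in a universally measurable way. No Markov property is asked for. -/
structure IsProcessFamily {E Ω : Type*} [MeasurableSpace E] [MeasurableSpace Ω]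
    (X₀ : Ω → E) (P : E → Measure Ω) : Prop where
  isProbabilityMeasure : ∀ x, IsProbabilityMeasure (P x)
  map_init : ∀ x, (P x).map X₀ = Measure.dirac x
  universallyMeasurable : ∀ F, MeasurableSet F → UniversallyMeasurable fun x => P x F

/-- A time-homogeneous càdlàg Markov family `(Ω, 𝓕, ℱ_t, X_t, P^x)` with transition probabilities
`p t x`. The Chapman-Kolmogorov equations and `p t x B = P x (X t ∈ B)` follow from `markov`. -/
structure IsCadlagMarkovFamily {E Ω : Type*} [TopologicalSpace E] [MeasurableSpace E]
    [mΩ : MeasurableSpace Ω] (ℱ : Filtration ℝ≥0 mΩ) (X : ℝ≥0 → Ω → E)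
    (p : ℝ≥0 → E → Measure E) (P : E → Measure Ω) : Prop extends IsProcessFamily (X 0) P where
  adapted : ∀ t, Measurable[ℱ t] (X t)
  cadlag : ∀ ω, IsCadlag fun t => X t ω
  transition_isProbabilityMeasure : ∀ t x, IsProbabilityMeasure (p t x)
  transition_universallyMeasurable : ∀ t B, MeasurableSet B →
    UniversallyMeasurable fun x => p t x B
  markov : ∀ x s t B, MeasurableSet B →
    (P x)[(X (t + s) ⁻¹' B).indicator (fun _ => (1 : ℝ)) | ℱ s]
      =ᵐ[P x] fun ω => (p t (X s ω)).real B

section Mixture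

variable {E Ω : Type*} [MeasurableSpace E] [MeasurableSpace Ω]

/-- The law `P^μ(F) = ∫ P^x(F) μ(dx)` of the process with initial distribution `μ`. -/
noncomputable def IsProcessFamily.law {X₀ : Ω → E} {P : E → Measure Ω}
    (hP : IsProcessFamily X₀ P) (μ : Measure E) [IsProbabilityMeasure μ] : Measure Ω :=
  Measure.ofMeasurable (fun F _ => ∫⁻ x, P x F ∂μ) (by simp) (by
    intro F hF hd
    rw [← lintegral_tsum fun i =>
      (hP.universallyMeasurable (F i) (hF i) μ inferInstance).aemeasurable]
    exact lintegral_congr fun x => measure_iUnion hd hF)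

theorem IsProcessFamily.law_apply {X₀ : Ω → E} {P : E → Measure Ω}
    (hP : IsProcessFamily X₀ P) (μ : Measure E) [IsProbabilityMeasure μ] {F : Set Ω}
    (hF : MeasurableSet F) : hP.law μ F = ∫⁻ x, P x F ∂μ :=
  Measure.ofMeasurable_apply F hF

end Mixture

/-- `μ` is invariant under the transition probabilities `p`. -/
def IsInvariantMeasure {E : Type*} [MeasurableSpace E] (p : ℝ≥0 → E → Measure E)
    (μ : Measure E) : Prop :=
  ∀ t B, MeasurableSet B → ∫⁻ x, p t x B ∂μ = μ B

/-- The Markov semigroup `𝒫_t[g](x) = ∫ g(y) p_t(x, dy)`. -/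
noncomputable def transitionOp {E : Type*} [MeasurableSpace E] (p : ℝ≥0 → E → Measure E)
    (t : ℝ≥0) (g : E → ℝ) : E → ℝ :=
  fun x => ∫ y, g y ∂(p t x)

/-- `HasGenerator p μ g h` says that the real-valued `g` lies in the domain of the generator `A` of
the Markov semigroup on `L²(μ)` and that `A[g] = h`: the difference quotients
`(𝒫_t[g] - g) / t` converge to `h` in `L²(μ)` as `t ↓ 0`. -/
def HasGenerator {E : Type*} [MeasurableSpace E] (p : ℝ≥0 → E → Measure E) (μ : Measure E)
    (g h : Lp ℝ 2 μ) : Prop :=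
  Tendsto (fun t : ℝ≥0 => eLpNorm (fun x => (transitionOp p t g x - g x) / (t : ℝ) - h x) 2 μ)
    (𝓝[>] 0) (𝓝 0)

/-- `κ(V) = sup {⟨A[g], g⟩ + ∫ V g² dμ : g ∈ D(A, ℝ), ‖g‖ = 1}`, as an extended real. -/
noncomputable def kappa {E : Type*} [MeasurableSpace E] (p : ℝ≥0 → E → Measure E) (μ : Measure E)
    (V : E → ℝ) : EReal :=
  sSup {r : EReal | ∃ g h : Lp ℝ 2 μ, HasGenerator p μ g h ∧ ‖g‖ = 1 ∧
    r = ((inner ℝ h g + ∫ x, V x * (g x) ^ 2 ∂μ : ℝ) : EReal)}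

/-- The time average `(1/T) ∫₀ᵀ f(X_t) dt`. -/
noncomputable def timeAverage {E Ω : Type*} (X : ℝ≥0 → Ω → E) (f : E → ℝ) (T : ℝ≥0) (ω : Ω) : ℝ :=
  (1 / (T : ℝ)) * ∫ t in (0 : ℝ)..(T : ℝ), f (X t.toNNReal ω)

/-- The relative entropy up to time `T` per unit time, `R(Q|_{ℱ_T} ‖ P|_{ℱ_T}) / T`. -/
noncomputable def relEntropyRate {Ω : Type*} [mΩ : MeasurableSpace Ω] (ℱ : Filtration ℝ≥0 mΩ)
    (Q P : Measure Ω) (T : ℝ≥0) : ℝ≥0∞ :=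
  InformationTheory.klDiv (Q.trim (ℱ.le T)) (P.trim (ℱ.le T)) / (T : ℝ≥0∞)

/-- `Ξ(Λ, η) = inf_{c > 0} (Λ(c) + η) / c`, for an extended-real-valued `Λ` and `η ∈ [0, ∞]`. -/
noncomputable def xiBound (Λ : ℝ → EReal) (η : ℝ≥0∞) : EReal :=
  ⨅ (c : ℝ) (_ : 0 < c), (Λ c + (η : EReal)) / (c : EReal)

/-!
Work under the stationary law `P^μ`, where every `X_t` has law `μ`, and let `J_t g = g ∘ X_t`, an
isometry from `L²(μ)` into `L²(P^μ)`. The transition operator is the compression `J₀† J_t`, and the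
Feynman-Kac operator for a bounded potential `V` is `S_t = J₀† exp(∫₀ᵗ V(X_r) dr) J_t`.

The time average is compared with the relative entropy by the Donsker-Varadhan inequality
`E_Q[F] ≤ R(Q ‖ P) + log E_P[exp F]` on `ℱ_T`, with `F = ∫₀ᵀ V(X_r) dr` and
`V = ± c (f - μ[f])` (`integral_le_toReal_klDiv_add_log`). It remains to show
`E^μ[exp ∫₀ᵀ V(X_r) dr] ≤ exp (κ(V) T)` (`IsStationaryMarkov.integral_exp_pathIntegral_le`).

The left-hand side is `⟪1, u(T)⟫` with `u(t) = S_t 1`. The operators `S_t` form a semigroup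
(`IsStationaryMarkov.fkOp_add`): on a grid of mesh `δ` the weight `exp ∫ V` is replaced by the
product of the factors `1 + ∫ V` over the cells. For a single cell the Markov property reduces by
Fubini's theorem to the one- and two-time Markov properties, so it holds exactly for the product,
and the error of the replacement tends to `0` with `δ`
(`IsStationaryMarkov.exists_gridWeight`, `IsStationaryMarkov.inner_weightOp`).
To first order in `t` the semigroups `S_t` and `J₀† J_t` differ by multiplication by `V`
(`IsStationaryMarkov.tendsto_fkOp_sub_div`). Applied to the constant function `1` this shows that
`u` has the right derivative `u'(t) = S_t V`, and applied to `u(t)` that `u(t)` lies in the domain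
of the generator, with `A u + V u = u'`. Hence `(‖u‖²)' = 2 ⟪A u + V u, u⟫ ≤ 2 κ(V) ‖u‖²`, and
Grönwall's inequality gives `‖u(T)‖ ≤ exp (κ(V) T)`.

The transition probabilities depend on the starting point in a universally measurable way only.
They are replaced by a Borel kernel agreeing with them `μ`-almost everywhere
(`exists_markovKernel_ae_eq`), which suffices because `X_s` has law `μ` under `P^μ`.
-/

/-! ### Laws and transition kernels -/

open ProbabilityTheory in
/-- A family of probability measures on a countably generated space, each of whose evaluations is
almost everywhere measurable, agrees almost everywhere with a Markov kernel: the countably many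
exceptional null sets of a generating algebra have null union. -/
theorem exists_markovKernel_ae_eq {α β : Type*} [MeasurableSpace α] [MeasurableSpace β]
    [MeasurableSpace.CountablyGenerated β] (μ : Measure α) [NeZero μ] (κ : α → Measure β)
    (hκ : ∀ x, IsProbabilityMeasure (κ x))
    (hm : ∀ B, MeasurableSet B → AEMeasurable (fun x => κ x B) μ) :
    ∃ q : Kernel α β, IsMarkovKernel q ∧ ∀ᵐ x ∂μ, κ x = q x := by
  classical
  obtain ⟨x₀⟩ : Nonempty α := by
    by_contra h
    rw [not_nonempty_iff] at h
    exact NeZero.ne μ μ.eq_zero_of_isEmpty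
  set S := generateSetAlgebra (MeasurableSpace.countableGeneratingSet β) with hS
  have hgen : ‹MeasurableSpace β› = .generateFrom S := by
    rw [hS, generateFrom_generateSetAlgebra_eq,
      MeasurableSpace.generateFrom_countableGeneratingSet]
  have hSm : ∀ B ∈ S, MeasurableSet B := fun B hB => by
    rw [hgen]; exact MeasurableSpace.measurableSet_generateFrom hB
  have hSc : S.Countable :=
    countable_generateSetAlgebra (MeasurableSpace.countable_countableGeneratingSet (α := β))
  have hpi : IsPiSystem S := isSetAlgebra_generateSetAlgebra.isSetRing.isSetSemiring.isPiSystem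
  have hae : ∀ᵐ x ∂μ, ∀ B : S, κ x B = (hm B (hSm B B.2)).mk _ x := by
    have := hSc.to_subtype
    exact ae_all_iff.2 fun B => (hm B (hSm B B.2)).ae_eq_mk
  obtain ⟨G, hGm, hG, hGsub⟩ := hae.exists_measurable_mem
  refine ⟨⟨fun x => if x ∈ G then κ x else κ x₀, ?_⟩, ⟨fun x => ?_⟩, ?_⟩
  · have : ∀ x, IsProbabilityMeasure (if x ∈ G then κ x else κ x₀) := fun x => by
      split_ifs <;> exact hκ _
    refine Measurable.measure_of_isPiSystem_of_isProbabilityMeasure hgen hpi fun B hB => ?_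
    have : (fun x => (if x ∈ G then κ x else κ x₀) B)
        = fun x => if x ∈ G then (hm B (hSm B hB)).mk _ x else κ x₀ B := by
      funext x
      split_ifs with h
      · exact hGsub x h ⟨B, hB⟩
      · rfl
    rw [this]
    exact Measurable.ite hG (hm B (hSm B hB)).measurable_mk measurable_const
  · change IsProbabilityMeasure (if x ∈ G then κ x else κ x₀)
    split_ifs <;> exact hκ _
  · filter_upwards [hGm] with x hx
    change κ x = if x ∈ G then κ x else κ x₀
    rw [if_pos hx]

section Law

variable {E Ω : Type*} [MeasurableSpace E] [MeasurableSpace Ω] {X₀ : Ω → E} {P : E → Measure Ω}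

theorem IsProcessFamily.aemeasurable_apply (hP : IsProcessFamily X₀ P) (μ : Measure E)
    [IsProbabilityMeasure μ] {F : Set Ω} (hF : MeasurableSet F) :
    AEMeasurable (fun x => P x F) μ :=
  (hP.universallyMeasurable F hF μ inferInstance).aemeasurable

theorem IsProcessFamily.isProbabilityMeasure_law (hP : IsProcessFamily X₀ P) (μ : Measure E)
    [IsProbabilityMeasure μ] : IsProbabilityMeasure (hP.law μ) := by
  refine ⟨?_⟩
  have := hP.isProbabilityMeasure
  simp [hP.law_apply μ MeasurableSet.univ]

/-- Integration against a mixture. The family `P` need not be an almost everywhere measurable map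
into the space of measures, since `Ω` is not assumed to be countably generated, so this does not
follow from the corresponding fact for `Measure.bind`. -/
theorem IsProcessFamily.aemeasurable_lintegral_and_lintegral_law (hP : IsProcessFamily X₀ P)
    (μ : Measure E) [IsProbabilityMeasure μ] {g : Ω → ℝ≥0∞} (hg : Measurable g) :
    AEMeasurable (fun x => ∫⁻ ω, g ω ∂(P x)) μ ∧
      ∫⁻ ω, g ω ∂(hP.law μ) = ∫⁻ x, ∫⁻ ω, g ω ∂(P x) ∂μ := by
  refine Measurable.ennreal_induction (motive := fun g => AEMeasurable (fun x => ∫⁻ ω, g ω ∂(P x)) μ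
    ∧ ∫⁻ ω, g ω ∂(hP.law μ) = ∫⁻ x, ∫⁻ ω, g ω ∂(P x) ∂μ)
    (fun c s hs => ?_) (fun f g hd hf hg ihf ihg => ?_) (fun f hf hmono ih => ?_) hg
  · simp only [lintegral_indicator_const hs, hP.law_apply μ hs]
    exact ⟨(hP.aemeasurable_apply μ hs).const_mul c,
      (lintegral_const_mul'' c (hP.aemeasurable_apply μ hs)).symm⟩
  · simp only [Pi.add_apply, lintegral_add_left hf]
    refine ⟨ihf.1.add ihg.1, ?_⟩
    rw [lintegral_add_left' ihf.1, ihf.2, ihg.2]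
  · have h : ∀ ν : Measure Ω, ∫⁻ ω, ⨆ n, f n ω ∂ν = ⨆ n, ∫⁻ ω, f n ω ∂ν := fun ν =>
      lintegral_iSup hf hmono
    simp only [h]
    refine ⟨AEMeasurable.iSup fun n => (ih n).1, ?_⟩
    rw [lintegral_iSup' (fun n => (ih n).1)]
    · exact iSup_congr fun n => (ih n).2
    · exact ae_of_all _ fun x m n hmn => lintegral_mono fun ω => hmono hmn ω

theorem IsProcessFamily.lintegral_law (hP : IsProcessFamily X₀ P)
    (μ : Measure E) [IsProbabilityMeasure μ] {g : Ω → ℝ≥0∞} (hg : Measurable g) :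
    ∫⁻ ω, g ω ∂(hP.law μ) = ∫⁻ x, ∫⁻ ω, g ω ∂(P x) ∂μ :=
  (hP.aemeasurable_lintegral_and_lintegral_law μ hg).2

end Law

/-! ### The Markov property under the stationary law -/

section Markov

variable {E Ω : Type*} [TopologicalSpace E] [MeasurableSpace E] [mΩ : MeasurableSpace Ω]
  {ℱ : Filtration ℝ≥0 mΩ} {X : ℝ≥0 → Ω → E}
  {p : ℝ≥0 → E → Measure E} {P : E → Measure Ω}

theorem IsCadlagMarkovFamily.measurable (hP : IsCadlagMarkovFamily ℱ X p P) (t : ℝ≥0) :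
    Measurable (X t) := (hP.adapted t).mono (ℱ.le t) le_rfl

/-- The Markov property in integrated form, under a single starting point. -/
theorem IsCadlagMarkovFamily.measure_inter_preimage (hP : IsCadlagMarkovFamily ℱ X p P) (x : E)
    (s t : ℝ≥0) {A : Set Ω} (hA : MeasurableSet[ℱ s] A) {B : Set E} (hB : MeasurableSet B) :
    P x (A ∩ X (t + s) ⁻¹' B) = ∫⁻ ω in A, p t (X s ω) B ∂(P x) := by
  have := hP.isProbabilityMeasure x
  have hBm : MeasurableSet (X (t + s) ⁻¹' B) := hP.measurable _ hB
  have hmk := hP.markov x s t B hB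
  have hint : Integrable ((X (t + s) ⁻¹' B).indicator (fun _ => (1 : ℝ))) (P x) :=
    (integrable_const 1).indicator hBm
  have h1 := setIntegral_condExp (ℱ.le s) hint hA
  rw [setIntegral_congr_ae ((ℱ.le s) A hA) (hmk.mono fun ω h _ => h),
    integral_indicator_const _ hBm] at h1
  have hint2 : Integrable (fun ω => (p t (X s ω)).real B) ((P x).restrict A) :=
    (integrable_condExp.congr hmk).restrict
  have h2 := ofReal_integral_eq_lintegral_ofReal hint2 (ae_of_all _ fun _ => measureReal_nonneg)
  rw [h1] at h2
  have hfin : ∀ ω, ENNReal.ofReal ((p t (X s ω)).real B) = p t (X s ω) B := fun ω => by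
    have := hP.transition_isProbabilityMeasure t (X s ω)
    exact ofReal_measureReal
  simp only [hfin] at h2
  rw [← h2]
  simp only [smul_eq_mul, mul_one]
  rw [ofReal_measureReal, Measure.restrict_apply hBm, Set.inter_comm]

variable [PolishSpace E] [BorelSpace E]

theorem IsCadlagMarkovFamily.measure_preimage (hP : IsCadlagMarkovFamily ℱ X p P) (x : E)
    (t : ℝ≥0) {B : Set E} (hB : MeasurableSet B) : P x (X t ⁻¹' B) = p t x B := by
  have := hP.isProbabilityMeasure x
  have h := hP.measure_inter_preimage x 0 t MeasurableSet.univ hB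
  have h0 : ∀ᵐ ω ∂(P x), X 0 ω = x := by
    have : ∀ᵐ y ∂((P x).map (X 0)), y = x := by
      rw [hP.map_init x, ae_dirac_eq]
      rfl
    exact ae_of_ae_map (hP.measurable 0).aemeasurable this
  rw [Set.univ_inter, add_zero, Measure.restrict_univ,
    lintegral_congr_ae (h0.mono fun ω h => by rw [h])] at h
  simpa using h

theorem IsCadlagMarkovFamily.measurePreserving (hP : IsCadlagMarkovFamily ℱ X p P)
    {μ : Measure E} [IsProbabilityMeasure μ] (hμ : IsInvariantMeasure p μ) (t : ℝ≥0) :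
    MeasurePreserving (X t) (hP.law μ) μ := by
  refine ⟨hP.measurable t, Measure.ext fun B hB => ?_⟩
  rw [Measure.map_apply (hP.measurable t) hB, hP.law_apply μ (hP.measurable t hB), ← hμ t B hB]
  exact lintegral_congr fun x => hP.measure_preimage x t hB

/-- Under the stationary law the Markov property can be written with any kernel that agrees
`μ`-almost everywhere with the transition probabilities: `P^μ`-almost surely, `X s` avoids the
exceptional set, so the same holds under `P^x` for `μ`-almost every `x`. -/
theorem IsCadlagMarkovFamily.law_inter_preimage (hP : IsCadlagMarkovFamily ℱ X p P)
    {μ : Measure E} [IsProbabilityMeasure μ] (hμ : IsInvariantMeasure p μ) {s t : ℝ≥0}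
    {q : ProbabilityTheory.Kernel E E} (hq : ∀ᵐ x ∂μ, p t x = q x) {A : Set Ω}
    (hA : MeasurableSet[ℱ s] A) {B : Set E} (hB : MeasurableSet B) :
    hP.law μ (A ∩ X (t + s) ⁻¹' B) = ∫⁻ ω in A, q (X s ω) B ∂(hP.law μ) := by
  have hAm := (ℱ.le s) A hA
  have hqm : Measurable fun ω => q (X s ω) B := (q.measurable_coe hB).comp (hP.measurable s)
  obtain ⟨G, hGm, hG, hGsub⟩ := hq.exists_measurable_mem
  have hXG : ∀ᵐ ω ∂(hP.law μ), X s ω ∈ G := (hP.measurePreserving hμ s).quasiMeasurePreserving.ae hGm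
  have hN : MeasurableSet (X s ⁻¹' Gᶜ) := hP.measurable s hG.compl
  have hx : ∀ᵐ x ∂μ, P x (X s ⁻¹' Gᶜ) = 0 := by
    have h0 : hP.law μ (X s ⁻¹' Gᶜ) = 0 := hXG
    rw [hP.law_apply μ hN, lintegral_eq_zero_iff' (hP.aemeasurable_apply μ hN)] at h0
    exact h0
  rw [hP.law_apply μ (hAm.inter (hP.measurable _ hB)), ← lintegral_indicator hAm,
    hP.lintegral_law μ (hqm.indicator hAm)]
  refine lintegral_congr_ae (hx.mono fun x hx => ?_)
  beta_reduce
  rw [lintegral_indicator hAm, hP.measure_inter_preimage x s t hA hB]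
  refine lintegral_congr_ae (ae_restrict_of_ae ?_)
  have hx' : ∀ᵐ ω ∂(P x), X s ω ∈ G := hx
  filter_upwards [hx'] with ω hω
  rw [hGsub _ hω]

theorem IsCadlagMarkovFamily.exists_kernel (hP : IsCadlagMarkovFamily ℱ X p P)
    (μ : Measure E) [IsProbabilityMeasure μ] (t : ℝ≥0) :
    ∃ q : ProbabilityTheory.Kernel E E, ProbabilityTheory.IsMarkovKernel q ∧
      ∀ᵐ x ∂μ, p t x = q x :=
  exists_markovKernel_ae_eq μ (p t) (hP.transition_isProbabilityMeasure t) fun B hB =>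
    (hP.transition_universallyMeasurable t B hB μ inferInstance).aemeasurable

end Markov

/-! ### Multiplication and composition operators on `L²` -/

section Operators

theorem real_inner_Lp_eq_integral_mul {α : Type*} [MeasurableSpace α] {ν : Measure α}
    (f g : Lp ℝ 2 ν) : inner ℝ f g = ∫ x, f x * g x ∂ν := by
  rw [L2.inner_def]
  exact integral_congr_ae (ae_of_all _ fun x => by simp [mul_comm])

theorem ae_abs_le_of_memLp_top {α : Type*} [MeasurableSpace α] {ν : Measure α} {Z : α → ℝ}
    (hZ : MemLp Z ∞ ν) : ∀ᵐ x ∂ν, |Z x| ≤ (eLpNorm Z ∞ ν).toReal := by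
  filter_upwards [enorm_ae_le_eLpNormEssSup Z ν] with x hx
  rw [eLpNorm_exponent_top, ← Real.norm_eq_abs, ← toReal_enorm]
  exact ENNReal.toReal_mono (by simpa using hZ.2.ne) hx

theorem memLp_top_mul {α : Type*} [MeasurableSpace α] {ν : Measure α} {Z g : α → ℝ}
    (hZ : MemLp Z ∞ ν) (hg : MemLp g 2 ν) : MemLp (fun x => Z x * g x) 2 ν := hg.mul hZ

/-- Multiplication by an essentially bounded function, as a bounded operator on `L²`. -/
noncomputable def mulOp {α : Type*} [MeasurableSpace α] {ν : Measure α} {Z : α → ℝ}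
    (hZ : MemLp Z ∞ ν) : Lp ℝ 2 ν →L[ℝ] Lp ℝ 2 ν :=
  LinearMap.mkContinuous
    { toFun := fun g => (memLp_top_mul hZ (Lp.memLp g)).toLp
      map_add' := fun f g => by
        ext1
        filter_upwards [MemLp.coeFn_toLp (memLp_top_mul hZ (Lp.memLp (f + g))),
          MemLp.coeFn_toLp (memLp_top_mul hZ (Lp.memLp f)),
          MemLp.coeFn_toLp (memLp_top_mul hZ (Lp.memLp g)), Lp.coeFn_add f g,
          Lp.coeFn_add ((memLp_top_mul hZ (Lp.memLp f)).toLp)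
            ((memLp_top_mul hZ (Lp.memLp g)).toLp)] with x h1 h2 h3 h4 h5
        rw [h1, h5, Pi.add_apply, h2, h3, h4, Pi.add_apply]
        ring
      map_smul' := fun c g => by
        ext1
        filter_upwards [MemLp.coeFn_toLp (memLp_top_mul hZ (Lp.memLp (c • g))),
          MemLp.coeFn_toLp (memLp_top_mul hZ (Lp.memLp g)), Lp.coeFn_smul c g,
          Lp.coeFn_smul c ((memLp_top_mul hZ (Lp.memLp g)).toLp)] with x h1 h2 h3 h4
        rw [h1, RingHom.id_apply, h4, Pi.smul_apply, h2, h3, Pi.smul_apply]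
        simp only [smul_eq_mul]
        ring }
    (eLpNorm Z ∞ ν).toReal fun g => by
      refine Lp.norm_le_mul_norm_of_ae_le_mul ?_
      filter_upwards [MemLp.coeFn_toLp (memLp_top_mul hZ (Lp.memLp g)),
        ae_abs_le_of_memLp_top hZ] with x h1 h2
      change ‖(memLp_top_mul hZ (Lp.memLp g)).toLp _ x‖ ≤ _
      rw [h1, norm_mul]
      exact mul_le_mul_of_nonneg_right h2 (norm_nonneg _)

theorem coeFn_mulOp {α : Type*} [MeasurableSpace α] {ν : Measure α} {Z : α → ℝ}
    (hZ : MemLp Z ∞ ν) (g : Lp ℝ 2 ν) : mulOp hZ g =ᵐ[ν] fun x => Z x * g x :=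
  MemLp.coeFn_toLp (memLp_top_mul hZ (Lp.memLp g))

theorem norm_mulOp_apply_le {α : Type*} [MeasurableSpace α] {ν : Measure α} {Z : α → ℝ}
    (hZ : MemLp Z ∞ ν) {C : ℝ} (hC : ∀ x, |Z x| ≤ C) (g : Lp ℝ 2 ν) :
    ‖mulOp hZ g‖ ≤ C * ‖g‖ := by
  refine Lp.norm_le_mul_norm_of_ae_le_mul ?_
  filter_upwards [coeFn_mulOp hZ g] with x h1
  rw [h1, norm_mul]
  exact mul_le_mul_of_nonneg_right (hC x) (norm_nonneg _)

theorem inner_mulOp_left {α : Type*} [MeasurableSpace α] {ν : Measure α} {Z : α → ℝ}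
    (hZ : MemLp Z ∞ ν) (f g : Lp ℝ 2 ν) : inner ℝ (mulOp hZ f) g = inner ℝ f (mulOp hZ g) := by
  rw [real_inner_Lp_eq_integral_mul, real_inner_Lp_eq_integral_mul]
  refine integral_congr_ae ?_
  filter_upwards [coeFn_mulOp hZ f, coeFn_mulOp hZ g] with x h1 h2
  rw [h1, h2]
  ring

/-- Composition with a measure preserving map, as an isometric operator between `L²` spaces. -/
noncomputable def compOp {α β : Type*} [MeasurableSpace α] [MeasurableSpace β] {ν : Measure α}
    {μ : Measure β} {Y : α → β} (hY : MeasurePreserving Y ν μ) : Lp ℝ 2 μ →L[ℝ] Lp ℝ 2 ν :=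
  (Lp.compMeasurePreservingₗᵢ ℝ Y hY).toContinuousLinearMap

theorem coeFn_compOp {α β : Type*} [MeasurableSpace α] [MeasurableSpace β] {ν : Measure α}
    {μ : Measure β} {Y : α → β} (hY : MeasurePreserving Y ν μ) (g : Lp ℝ 2 μ) :
    compOp hY g =ᵐ[ν] fun x => g (Y x) :=
  Lp.coeFn_compMeasurePreserving g hY

theorem norm_compOp {α β : Type*} [MeasurableSpace α] [MeasurableSpace β] {ν : Measure α}
    {μ : Measure β} {Y : α → β} (hY : MeasurePreserving Y ν μ) (g : Lp ℝ 2 μ) :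
    ‖compOp hY g‖ = ‖g‖ :=
  Lp.norm_compMeasurePreserving g hY

theorem inner_compOp_compOp {α β : Type*} [MeasurableSpace α] [MeasurableSpace β] {ν : Measure α}
    {μ : Measure β} {Y : α → β} (hY : MeasurePreserving Y ν μ) (f g : Lp ℝ 2 μ) :
    inner ℝ (compOp hY f) (compOp hY g) = inner ℝ f g :=
  (Lp.compMeasurePreservingₗᵢ ℝ Y hY).inner_map_map f g

theorem adjoint_compOp_compOp {α β : Type*} [MeasurableSpace α] [MeasurableSpace β] {ν : Measure α}
    {μ : Measure β} {Y : α → β} (hY : MeasurePreserving Y ν μ) (g : Lp ℝ 2 μ) :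
    (compOp hY).adjoint (compOp hY g) = g :=
  ext_inner_right ℝ fun f => by
    rw [ContinuousLinearMap.adjoint_inner_left, inner_compOp_compOp]

theorem norm_adjoint_compOp_le {α β : Type*} [MeasurableSpace α] [MeasurableSpace β] {ν : Measure α}
    {μ : Measure β} {Y : α → β} (hY : MeasurePreserving Y ν μ) (W : Lp ℝ 2 ν) :
    ‖(compOp hY).adjoint W‖ ≤ ‖W‖ := by
  have h : ‖(compOp hY).adjoint‖ ≤ 1 := by
    rw [LinearIsometryEquiv.norm_map]
    exact ContinuousLinearMap.opNorm_le_bound _ zero_le_one fun g => by rw [norm_compOp, one_mul]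
  simpa using ContinuousLinearMap.le_of_opNorm_le _ h W

theorem compOp_mulOp {α β : Type*} [MeasurableSpace α] [MeasurableSpace β] {ν : Measure α}
    {μ : Measure β} {Y : α → β} (hY : MeasurePreserving Y ν μ) {V : β → ℝ} (hV : MemLp V ∞ μ)
    (hVY : MemLp (fun x => V (Y x)) ∞ ν) (g : Lp ℝ 2 μ) :
    compOp hY (mulOp hV g) = mulOp hVY (compOp hY g) := by
  ext1
  filter_upwards [coeFn_compOp hY (mulOp hV g), coeFn_mulOp hVY (compOp hY g), coeFn_compOp hY g,
    hY.quasiMeasurePreserving.ae (coeFn_mulOp hV g)] with x h1 h2 h3 h4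
  rw [h1, h2, h3, h4]

end Operators

/-! ### Stationary Markov processes in terms of `L²` operators -/

/-- A stationary Markov process with right-continuous paths and marginal law `μ`. The transition
operator over a time span `t` is the compression `J₀† J_t`, where `J_t g = g ∘ X_t`, and the Markov
property is tested against square-integrable random variables known at time `s`. -/
structure IsStationaryMarkov {E Ω : Type*} [TopologicalSpace E] [MeasurableSpace E]
    [mΩ : MeasurableSpace Ω] (ℱ : Filtration ℝ≥0 mΩ) (X : ℝ≥0 → Ω → E) (Pr : Measure Ω)
    (μ : Measure E) : Prop where
  adapted : ∀ t, Measurable[ℱ t] (X t)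
  rightCont : ∀ ω t, ContinuousWithinAt (fun t => X t ω) (Set.Ici t) t
  mp : ∀ t, MeasurePreserving (X t) Pr μ
  markov : ∀ s t (W : Lp ℝ 2 Pr) (g : Lp ℝ 2 μ), AEStronglyMeasurable[ℱ s] W Pr →
    inner ℝ W (compOp (mp (s + t)) g)
      = inner ℝ W (compOp (mp s) ((compOp (mp 0)).adjoint (compOp (mp t) g)))

section

variable {E Ω : Type*} [TopologicalSpace E] [MeasurableSpace E] [mΩ : MeasurableSpace Ω]
  {ℱ : Filtration ℝ≥0 mΩ} {X : ℝ≥0 → Ω → E} {p : ℝ≥0 → E → Measure E} {P : E → Measure Ω}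
  [PolishSpace E] [BorelSpace E]

open ProbabilityTheory in
/-- The Markov property for square-integrable observables. -/
theorem IsCadlagMarkovFamily.condExp_law (hP : IsCadlagMarkovFamily ℱ X p P)
    {μ : Measure E} [IsProbabilityMeasure μ] (hμ : IsInvariantMeasure p μ) {s t : ℝ≥0}
    {q : Kernel E E} [IsMarkovKernel q] (hq : ∀ᵐ x ∂μ, p t x = q x) (g : Lp ℝ 2 μ) :
    (fun ω => ∫ y, g y ∂(q (X s ω))) =ᵐ[hP.law μ]
      (hP.law μ)[fun ω => g (X (s + t) ω) | ℱ s] := by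
  have := hP.isProbabilityMeasure_law μ
  have hgm : StronglyMeasurable g := Lp.stronglyMeasurable g
  have hgint : Integrable (fun ω => g (X (s + t) ω)) (hP.law μ) :=
    (hP.measurePreserving hμ (s + t)).integrable_comp_of_integrable
      ((Lp.memLp g).integrable one_le_two)
  have hcomp : ∀ A, MeasurableSet[ℱ s] A → ((hP.law μ).restrict A).map (X (s + t))
      = q ∘ₘ ((hP.law μ).restrict A).map (X s) := by
    intro A hA
    ext B hB
    rw [Measure.map_apply (hP.measurable _) hB, Measure.restrict_apply (hP.measurable _ hB),
      Measure.bind_apply hB q.aemeasurable, lintegral_map (q.measurable_coe hB) (hP.measurable s),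
      Set.inter_comm, add_comm s t, hP.law_inter_preimage hμ hq hA hB]
  have hint : ∀ A, MeasurableSet[ℱ s] A →
      Integrable g (q ∘ₘ ((hP.law μ).restrict A).map (X s)) := by
    intro A hA
    rw [← hcomp A hA, integrable_map_measure hgm.aestronglyMeasurable
      (hP.measurable _).aemeasurable]
    exact hgint.restrict
  have hQm : StronglyMeasurable fun x => ∫ y, g y ∂(q x) := hgm.integral_kernel
  have hint2 : ∀ A, MeasurableSet[ℱ s] A →
      Integrable (fun x => ∫ y, g y ∂(q x)) (((hP.law μ).restrict A).map (X s)) := by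
    intro A hA
    refine (Measure.integrable_integral_norm_of_integrable_comp (hint A hA)).mono'
      hQm.aestronglyMeasurable (ae_of_all _ fun x => norm_integral_le_integral_norm _)
  refine ae_eq_condExp_of_forall_setIntegral_eq (ℱ.le s) hgint ?_ ?_ ?_
  · intro A hA _
    exact (integrable_map_measure hQm.aestronglyMeasurable (hP.measurable s).aemeasurable).1
      (hint2 A hA)
  · intro A hA _
    rw [← integral_map (hP.measurable s).aemeasurable hQm.aestronglyMeasurable,
      ← integral_map (hP.measurable _).aemeasurable hgm.aestronglyMeasurable, hcomp A hA]
    have h1 := Measure.integral_compProd ((Measure.integrable_compProd_snd_iff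
      hgm.aestronglyMeasurable).2 (hint A hA))
    rw [← h1, ← Measure.snd_compProd, Measure.snd, integral_map measurable_snd.aemeasurable
      hgm.aestronglyMeasurable]
  · exact (hQm.comp_measurable (hP.adapted s)).aestronglyMeasurable

/-- The `L²` transition operator acts as the integral against the transition probabilities. -/
theorem IsCadlagMarkovFamily.adjoint_compOp_ae_eq (hP : IsCadlagMarkovFamily ℱ X p P)
    {μ : Measure E} [IsProbabilityMeasure μ] (hμ : IsInvariantMeasure p μ) (t : ℝ≥0)
    (g : Lp ℝ 2 μ) :
    (compOp (hP.measurePreserving hμ 0)).adjoint (compOp (hP.measurePreserving hμ t) g)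
      =ᵐ[μ] transitionOp p t g := by
  have := hP.isProbabilityMeasure_law μ
  obtain ⟨q, hqM, hq⟩ := hP.exists_kernel μ t
  have hc := hP.condExp_law hμ (s := 0) hq g
  have hQm : StronglyMeasurable fun x => ∫ y, g y ∂(q x) :=
    (Lp.stronglyMeasurable g).integral_kernel
  have hgX : MemLp (fun ω => g (X (0 + t) ω)) 2 (hP.law μ) :=
    (Lp.memLp g).comp_measurePreserving (hP.measurePreserving hμ _)
  have hdesc : ∀ Q : E → ℝ, StronglyMeasurable Q → MemLp (Q ∘ X 0) 2 (hP.law μ) → MemLp Q 2 μ :=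
    fun Q hQ h => by
      rwa [← (hP.measurePreserving hμ 0).map_eq,
        memLp_map_measure_iff hQ.aestronglyMeasurable (hP.measurable 0).aemeasurable]
  have hQ : MemLp (fun x => ∫ y, g y ∂(q x)) 2 μ :=
    hdesc _ hQm ((memLp_congr_ae hc).2 (hgX.condExp one_le_two))
  have hkey : (compOp (hP.measurePreserving hμ 0)).adjoint (compOp (hP.measurePreserving hμ t) g)
      = hQ.toLp := by
    refine ext_inner_left ℝ fun k => ?_
    rw [ContinuousLinearMap.adjoint_inner_right, ← inner_compOp_compOp (hP.measurePreserving hμ 0),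
      real_inner_Lp_eq_integral_mul, real_inner_Lp_eq_integral_mul]
    have hkm : AEStronglyMeasurable[ℱ 0] (fun ω => k (X 0 ω)) (hP.law μ) :=
      ((Lp.stronglyMeasurable k).comp_measurable (hP.adapted 0)).aestronglyMeasurable
    have hk2 : MemLp (fun ω => k (X 0 ω)) 2 (hP.law μ) :=
      (Lp.memLp k).comp_measurePreserving (hP.measurePreserving hμ _)
    have hpull := condExp_mul_of_aestronglyMeasurable_left hkm (hk2.integrable_mul hgX)
      (hgX.integrable one_le_two)
    have h1 := integral_condExp (μ := hP.law μ) (ℱ.le 0)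
      (f := (fun ω => k (X 0 ω)) * fun ω => g (X (0 + t) ω))
    rw [integral_congr_ae hpull] at h1
    calc _ = ∫ ω, k (X 0 ω) * g (X (0 + t) ω) ∂(hP.law μ) := by
          refine integral_congr_ae ?_
          filter_upwards [coeFn_compOp (hP.measurePreserving hμ 0) k,
            coeFn_compOp (hP.measurePreserving hμ t) g] with ω h1 h2
          rw [h1, h2, zero_add]
      _ = _ := h1.symm
      _ = _ := by
          refine integral_congr_ae ?_
          filter_upwards [coeFn_compOp (hP.measurePreserving hμ 0) k,
            coeFn_compOp (hP.measurePreserving hμ 0) hQ.toLp, hc,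
            (hP.measurePreserving hμ 0).quasiMeasurePreserving.ae hQ.coeFn_toLp] with ω h1 h2 h3 h4
          rw [Pi.mul_apply, h1, h2, h4, ← h3]
  rw [hkey]
  refine hQ.coeFn_toLp.trans ?_
  filter_upwards [hq] with x hx
  rw [transitionOp, hx]

theorem IsCadlagMarkovFamily.isStationaryMarkov (hP : IsCadlagMarkovFamily ℱ X p P)
    {μ : Measure E} [IsProbabilityMeasure μ] (hμ : IsInvariantMeasure p μ) :
    IsStationaryMarkov ℱ X (hP.law μ) μ where
  adapted := hP.adapted
  rightCont := fun ω t => (hP.cadlag ω t).1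
  mp := hP.measurePreserving hμ
  markov := fun s t W g hW => by
    have := hP.isProbabilityMeasure_law μ
    obtain ⟨q, hqM, hq⟩ := hP.exists_kernel μ t
    have hc := hP.condExp_law hμ (s := s) hq g
    have hgX : MemLp (fun ω => g (X (s + t) ω)) 2 (hP.law μ) :=
      (Lp.memLp g).comp_measurePreserving (hP.measurePreserving hμ _)
    have hpull := condExp_mul_of_aestronglyMeasurable_left hW ((Lp.memLp W).integrable_mul hgX)
      (hgX.integrable one_le_two)
    have h1 := integral_condExp (μ := hP.law μ) (ℱ.le s)
      (f := (W : Ω → ℝ) * fun ω => g (X (s + t) ω))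
    rw [integral_congr_ae hpull] at h1
    rw [real_inner_Lp_eq_integral_mul, real_inner_Lp_eq_integral_mul]
    calc _ = ∫ ω, W ω * g (X (s + t) ω) ∂(hP.law μ) := by
          refine integral_congr_ae ?_
          filter_upwards [coeFn_compOp (hP.measurePreserving hμ (s + t)) g] with ω h2
          rw [h2]
      _ = _ := h1.symm
      _ = _ := by
          refine integral_congr_ae ?_
          filter_upwards [hc, coeFn_compOp (hP.measurePreserving hμ s)
              ((compOp (hP.measurePreserving hμ 0)).adjoint
                (compOp (hP.measurePreserving hμ t) g)),
            (hP.measurePreserving hμ s).quasiMeasurePreserving.ae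
              (hP.adjoint_compOp_ae_eq hμ t g),
            (hP.measurePreserving hμ s).quasiMeasurePreserving.ae hq] with ω h1 h2 h3 h4
          rw [Pi.mul_apply, h2, h3, ← h1, transitionOp, h4]

end

/-! ### Joint measurability and additive functionals -/

/-- A process with measurable marginals and right-continuous paths is jointly measurable: it is the
pointwise limit of its values at the next point of the grid of mesh `1 / (n + 1)`. -/
theorem measurable_uncurry_of_rightCont {E Ω : Type*} [TopologicalSpace E]
    [TopologicalSpace.PseudoMetrizableSpace E] [MeasurableSpace E] [BorelSpace E]
    [MeasurableSpace Ω] {Y : ℝ≥0 → Ω → E} (hY : ∀ t, Measurable (Y t))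
    (hc : ∀ ω t, ContinuousWithinAt (fun t => Y t ω) (Set.Ici t) t) :
    Measurable fun z : ℝ≥0 × Ω => Y z.1 z.2 := by
  let D : ℕ → ℝ≥0 → ℝ≥0 := fun n r => ((⌊((n : ℝ≥0) + 1) * r⌋₊ : ℝ≥0) + 1) / ((n : ℝ≥0) + 1)
  have hpos : ∀ n : ℕ, (0 : ℝ≥0) < (n : ℝ≥0) + 1 := fun n => by positivity
  have hDlow : ∀ n r, r ≤ D n r := fun n r => by
    rw [le_div_iff₀ (hpos n), mul_comm]
    exact (Nat.lt_floor_add_one _).le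
  have hDup : ∀ n r, D n r ≤ r + 1 / ((n : ℝ≥0) + 1) := fun n r => by
    rw [div_le_iff₀ (hpos n), add_mul r, one_div, inv_mul_cancel₀ (hpos n).ne', mul_comm r]
    gcongr
    exact Nat.floor_le zero_le
  have hDlim : ∀ r, Tendsto (fun n => D n r) atTop (𝓝 r) := fun r => by
    refine tendsto_of_tendsto_of_tendsto_of_le_of_le tendsto_const_nhds ?_
      (fun n => hDlow n r) (fun n => hDup n r)
    have h := tendsto_one_div_add_atTop_nhds_zero_nat (𝕜 := ℝ≥0)
    simpa using h.const_add r
  refine measurable_of_tendsto_metrizable (f := fun n z => Y (D n z.1) z.2) (fun n => ?_) ?_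
  · have hk : ∀ d : ℕ → ℝ≥0, Measurable fun z : Ω × ℕ => Y (d z.2) z.1 := fun d =>
      measurable_from_prod_countable_left fun k => hY (d k)
    have hfl : Measurable fun z : ℝ≥0 × Ω => (z.2, ⌊((n : ℝ≥0) + 1) * z.1⌋₊) :=
      measurable_snd.prodMk (Nat.measurable_floor.comp (measurable_fst.const_mul _))
    have h3 := (hk fun k => ((k : ℝ≥0) + 1) / ((n : ℝ≥0) + 1)).comp hfl
    simpa only [Function.comp_def] using h3
  · refine tendsto_pi_nhds.2 fun z => ?_
    exact (hc z.2 z.1).tendsto.comp (tendsto_nhdsWithin_iff.2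
      ⟨hDlim z.1, Eventually.of_forall fun n => hDlow n z.1⟩)

/-- Stopping the process at `T` keeps it measurable with respect to the information at time `T`. -/
theorem measurable_comp_min_of_rightCont {E Ω : Type*} [TopologicalSpace E]
    [TopologicalSpace.PseudoMetrizableSpace E] [MeasurableSpace E] [BorelSpace E]
    [MeasurableSpace Ω] {X : ℝ≥0 → Ω → E} {T : ℝ≥0} (hX : ∀ t ≤ T, Measurable (X t))
    (hc : ∀ ω t, ContinuousWithinAt (fun t => X t ω) (Set.Ici t) t) :
    Measurable fun z : ℝ × Ω => X (min z.1.toNNReal T) z.2 := by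
  have h := measurable_uncurry_of_rightCont (Y := fun t => X (min t T))
    (fun t => hX _ (min_le_right t T)) fun ω t => by
      refine ContinuousWithinAt.comp (t := Set.Ici (min t T)) (g := fun t => X t ω)
        (f := fun t => min t T) (hc ω _) (by fun_prop) fun r hr => ?_
      exact min_le_min_right T hr
  exact h.comp ((measurable_real_toNNReal.comp measurable_fst).prodMk measurable_snd)

/-- The additive functional `∫ₛᵗ V(X_r) dr`. -/
noncomputable def pathIntegral {E Ω : Type*} (X : ℝ≥0 → Ω → E) (V : E → ℝ) (s t : ℝ≥0) (ω : Ω) :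
    ℝ := ∫ r in (s : ℝ)..t, V (X r.toNNReal ω)

theorem measurable_pathIntegral {E Ω : Type*} [TopologicalSpace E]
    [TopologicalSpace.PseudoMetrizableSpace E] [MeasurableSpace E] [BorelSpace E]
    [mΩ : MeasurableSpace Ω] {X : ℝ≥0 → Ω → E} {s t : ℝ≥0} (hst : s ≤ t)
    (hX : ∀ r ≤ t, Measurable (X r))
    (hc : ∀ ω t, ContinuousWithinAt (fun t => X t ω) (Set.Ici t) t)
    {V : E → ℝ} (hV : Measurable V) : Measurable (pathIntegral X V s t) := by
  have h := (hV.comp (measurable_comp_min_of_rightCont hX hc)).comp measurable_swap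
  have h2 : Measurable fun ω => ∫ r in Set.Ioc (s : ℝ) t, V (X (min r.toNNReal t) ω) :=
    (h.stronglyMeasurable.integral_prod_right' (ν := volume.restrict (Set.Ioc (s : ℝ) t))).measurable
  convert h2 using 2 with ω
  rw [pathIntegral, intervalIntegral.integral_of_le (by exact_mod_cast hst)]
  refine setIntegral_congr_fun measurableSet_Ioc fun r hr => ?_
  have : r.toNNReal ≤ t := Real.toNNReal_le_iff_le_coe.2 hr.2
  simp only [min_eq_left this]

theorem abs_pathIntegral_le {E Ω : Type*} {X : ℝ≥0 → Ω → E} {V : E → ℝ} {C : ℝ≥0}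
    (hC : ∀ x, |V x| ≤ C) (s t : ℝ≥0) (ω : Ω) : |pathIntegral X V s t ω| ≤ C * |(t : ℝ) - s| :=
  intervalIntegral.norm_integral_le_of_norm_le_const (f := fun r : ℝ => V (X r.toNNReal ω))
    fun _ _ => hC _

section PathIntegral

variable {E Ω : Type*} [TopologicalSpace E] [TopologicalSpace.PseudoMetrizableSpace E]
  [MeasurableSpace E] [BorelSpace E] [MeasurableSpace Ω] {X : ℝ≥0 → Ω → E} {V : E → ℝ} {C : ℝ≥0}

theorem measurable_uncurry_comp_of_rightCont (hX : ∀ t, Measurable (X t))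
    (hc : ∀ ω t, ContinuousWithinAt (fun t => X t ω) (Set.Ici t) t) (hV : Measurable V) :
    Measurable fun z : ℝ × Ω => V (X z.1.toNNReal z.2) :=
  hV.comp ((measurable_uncurry_of_rightCont hX hc).comp
    ((measurable_real_toNNReal.comp measurable_fst).prodMk measurable_snd))

theorem intervalIntegrable_comp_path (hX : ∀ t, Measurable (X t))
    (hc : ∀ ω t, ContinuousWithinAt (fun t => X t ω) (Set.Ici t) t) (hV : Measurable V)
    (hC : ∀ x, |V x| ≤ C) (a b : ℝ) (ω : Ω) :
    IntervalIntegrable (fun r => V (X r.toNNReal ω)) volume a b := by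
  have hm : Measurable fun r : ℝ => V (X r.toNNReal ω) :=
    (measurable_uncurry_comp_of_rightCont hX hc hV).comp (measurable_id.prodMk measurable_const)
  exact (intervalIntegrable_const (c := (C : ℝ))).mono_fun hm.aestronglyMeasurable
    (ae_of_all _ fun r => by simpa using hC _)

theorem pathIntegral_add (hX : ∀ t, Measurable (X t))
    (hc : ∀ ω t, ContinuousWithinAt (fun t => X t ω) (Set.Ici t) t) (hV : Measurable V)
    (hC : ∀ x, |V x| ≤ C) (r s t : ℝ≥0) (ω : Ω) :
    pathIntegral X V r s ω + pathIntegral X V s t ω = pathIntegral X V r t ω :=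
  intervalIntegral.integral_add_adjacent_intervals
    (intervalIntegrable_comp_path hX hc hV hC _ _ ω) (intervalIntegrable_comp_path hX hc hV hC _ _ ω)

theorem integrable_prod_comp_path_mul (hX : ∀ t, Measurable (X t))
    (hc : ∀ ω t, ContinuousWithinAt (fun t => X t ω) (Set.Ici t) t) (hV : Measurable V)
    (hC : ∀ x, |V x| ≤ C) {Pr : Measure Ω} [SFinite Pr] {F : Ω → ℝ} (hF : Integrable F Pr)
    (a b : ℝ) :
    Integrable (fun z : ℝ × Ω => V (X z.1.toNNReal z.2) * F z.2)
      ((volume.restrict (Set.uIoc a b)).prod Pr) := by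
  have : IsFiniteMeasure (volume.restrict (Set.uIoc a b)) :=
    isFiniteMeasure_restrict.2 (by rw [Set.uIoc]; exact measure_Ioc_lt_top.ne)
  have h1 : Integrable (fun z : ℝ × Ω => F z.2) ((volume.restrict (Set.uIoc a b)).prod Pr) :=
    hF.comp_snd _
  exact h1.bdd_mul (c := (C : ℝ))
    (measurable_uncurry_comp_of_rightCont hX hc hV).aestronglyMeasurable (ae_of_all _ fun z => hC _)

/-- Fubini's theorem for the additive functional. -/
theorem integral_pathIntegral_mul (hX : ∀ t, Measurable (X t))
    (hc : ∀ ω t, ContinuousWithinAt (fun t => X t ω) (Set.Ici t) t) (hV : Measurable V)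
    (hC : ∀ x, |V x| ≤ C) {Pr : Measure Ω} [SFinite Pr] {F : Ω → ℝ} (hF : Integrable F Pr)
    (s t : ℝ≥0) :
    ∫ ω, pathIntegral X V s t ω * F ω ∂Pr
      = ∫ r in (s : ℝ)..t, ∫ ω, V (X r.toNNReal ω) * F ω ∂Pr := by
  rw [intervalIntegral_integral_swap (integrable_prod_comp_path_mul hX hc hV hC hF _ _)]
  simp only [pathIntegral, intervalIntegral.integral_mul_const]

end PathIntegral

/-! ### A Grönwall estimate -/

/-- Grönwall's inequality for `‖u‖²`: if `⟪u, u'⟫ ≤ k ‖u‖²`, then `u` grows at most like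
`exp (k t)`. -/
theorem norm_le_exp_mul_of_inner_deriv_right_le {H : Type*} [NormedAddCommGroup H]
    [InnerProductSpace ℝ H] {u v : ℝ → H} {k : ℝ} (hu : Continuous u)
    (hderiv : ∀ x, 0 ≤ x → HasDerivWithinAt u (v x) (Set.Ici x) x)
    (hk : ∀ x, 0 ≤ x → inner ℝ (u x) (v x) ≤ k * ‖u x‖ ^ 2) {T : ℝ} (hT : 0 ≤ T) :
    ‖u T‖ ≤ Real.exp (k * T) * ‖u 0‖ := by
  have hgron := le_gronwallBound_of_liminf_deriv_right_le (f := fun x => ‖u x‖ ^ 2)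
    (f' := fun x => 2 * inner ℝ (u x) (v x)) (δ := ‖u 0‖ ^ 2) (K := 2 * k) (ε := 0) (a := 0) (b := T)
    (hu.norm.pow 2).continuousOn
    (fun x hx r hr => by
      have h2 := ((hderiv x hx.1).norm_sq).liminf_right_slope_le hr
      simpa only [slope_def_field, div_eq_inv_mul] using h2)
    le_rfl (fun x hx => by have := hk x hx.1; linarith) T ⟨hT, le_rfl⟩
  rw [gronwallBound_ε0, sub_zero] at hgron
  have h2 : ‖u 0‖ ^ 2 * Real.exp (2 * k * T) = (Real.exp (k * T) * ‖u 0‖) ^ 2 := by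
    rw [mul_pow, ← Real.exp_nat_mul, mul_comm]
    congr 2
    push_cast
    ring
  rw [h2] at hgron
  exact (sq_le_sq₀ (norm_nonneg _) (by positivity)).1 hgron

/-! ### The Feynman-Kac semigroup -/

namespace IsStationaryMarkov

variable {E Ω : Type*} [TopologicalSpace E] [TopologicalSpace.PseudoMetrizableSpace E]
  [MeasurableSpace E] [BorelSpace E] [mΩ : MeasurableSpace Ω] {ℱ : Filtration ℝ≥0 mΩ}
  {X : ℝ≥0 → Ω → E} {Pr : Measure Ω} {μ : Measure E} {V : E → ℝ} {C : ℝ≥0}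

omit [TopologicalSpace.PseudoMetrizableSpace E] [BorelSpace E] in
theorem measurable (h : IsStationaryMarkov ℱ X Pr μ) (t : ℝ≥0) : Measurable (X t) :=
  (h.adapted t).mono (ℱ.le t) le_rfl

theorem measurable_pathIntegral_filtration (h : IsStationaryMarkov ℱ X Pr μ) (hV : Measurable V)
    {s t : ℝ≥0} (hst : s ≤ t) : Measurable[ℱ t] (pathIntegral X V s t) :=
  measurable_pathIntegral (mΩ := ℱ t) hst
    (fun r hr => (h.adapted r).mono (ℱ.mono hr) le_rfl) h.rightCont hV

omit [TopologicalSpace.PseudoMetrizableSpace E] [BorelSpace E] in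
theorem memLp_top_comp (h : IsStationaryMarkov ℱ X Pr μ) (hV : Measurable V)
    (hC : ∀ x, |V x| ≤ C) (t : ℝ≥0) : MemLp (fun ω => V (X t ω)) ∞ Pr :=
  memLp_top_of_bound (hV.comp (h.measurable t)).aestronglyMeasurable C (ae_of_all _ fun _ => hC _)

theorem measurable_pathIntegral_ambient (h : IsStationaryMarkov ℱ X Pr μ) (hV : Measurable V)
    (s t : ℝ≥0) : Measurable (pathIntegral X V s t) := by
  rcases le_total s t with hst | hst
  · exact (h.measurable_pathIntegral_filtration hV hst).mono (ℱ.le t) le_rfl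
  · have h1 : pathIntegral X V s t = fun ω => -pathIntegral X V t s ω :=
      funext fun ω => intervalIntegral.integral_symm _ _
    rw [h1]
    exact ((h.measurable_pathIntegral_filtration hV hst).mono (ℱ.le s) le_rfl).neg

theorem memLp_top_pathIntegral (h : IsStationaryMarkov ℱ X Pr μ) (hV : Measurable V)
    (hC : ∀ x, |V x| ≤ C) (s t : ℝ≥0) : MemLp (pathIntegral X V s t) ∞ Pr :=
  memLp_top_of_bound (h.measurable_pathIntegral_ambient hV s t).aestronglyMeasurable
    (C * |(t : ℝ) - s|) (ae_of_all _ fun ω => abs_pathIntegral_le hC s t ω)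

theorem memLp_top_exp (h : IsStationaryMarkov ℱ X Pr μ) (hV : Measurable V)
    (hC : ∀ x, |V x| ≤ C) (s t : ℝ≥0) :
    MemLp (fun ω => Real.exp (pathIntegral X V s t ω)) ∞ Pr :=
  memLp_top_of_bound (h.measurable_pathIntegral_ambient hV s t).exp.aestronglyMeasurable
    (Real.exp (C * |(t : ℝ) - s|)) (ae_of_all _ fun ω => by
      rw [Real.norm_eq_abs, Real.abs_exp]
      exact Real.exp_le_exp.2 ((le_abs_self _).trans (abs_pathIntegral_le hC s t ω)))

/-- The isometry `g ↦ g ∘ X_t` from `L²` of the invariant measure to `L²` of the process. -/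
noncomputable abbrev J (h : IsStationaryMarkov ℱ X Pr μ) (t : ℝ≥0) : Lp ℝ 2 μ →L[ℝ] Lp ℝ 2 Pr :=
  compOp (h.mp t)

/-- Multiplication by `exp (∫ₛᵗ V(X_r) dr)`. -/
noncomputable abbrev weightOp (h : IsStationaryMarkov ℱ X Pr μ) (hV : Measurable V)
    (hC : ∀ x, |V x| ≤ C) (s t : ℝ≥0) : Lp ℝ 2 Pr →L[ℝ] Lp ℝ 2 Pr :=
  mulOp (h.memLp_top_exp hV hC s t)

/-- The Feynman-Kac operator `g ↦ E[exp (∫₀ᵗ V(X_r) dr) g(X_t) | X₀ = ·]` on `L²(μ)`. -/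
noncomputable def fkOp (h : IsStationaryMarkov ℱ X Pr μ) (hV : Measurable V)
    (hC : ∀ x, |V x| ≤ C) (t : ℝ≥0) : Lp ℝ 2 μ →L[ℝ] Lp ℝ 2 μ :=
  (h.J 0).adjoint ∘L h.weightOp hV hC 0 t ∘L h.J t

/-- The first order approximation `g ↦ E[(1 + ∫₀ᵟ V(X_r) dr) g(X_δ) | X₀ = ·]` of the Feynman-Kac
operator over a short time span. -/
noncomputable def eulerOp (h : IsStationaryMarkov ℱ X Pr μ) (hV : Measurable V)
    (hC : ∀ x, |V x| ≤ C) (δ : ℝ≥0) : Lp ℝ 2 μ →L[ℝ] Lp ℝ 2 μ :=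
  (h.J 0).adjoint ∘L (h.J δ + mulOp (h.memLp_top_pathIntegral hV hC 0 δ) ∘L h.J δ)

theorem inner_mulOp_pathIntegral [IsProbabilityMeasure Pr] (h : IsStationaryMarkov ℱ X Pr μ)
    (hV : Measurable V) (hC : ∀ x, |V x| ≤ C) (s t : ℝ≥0) (W G : Lp ℝ 2 Pr) :
    inner ℝ W (mulOp (h.memLp_top_pathIntegral hV hC s t) G)
      = ∫ r in (s : ℝ)..t, inner ℝ W (mulOp (h.memLp_top_comp hV hC r.toNNReal) G) := by
  have hWG : Integrable (fun ω => W ω * G ω) Pr := (Lp.memLp W).integrable_mul (Lp.memLp G)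
  have h1 := integral_pathIntegral_mul h.measurable h.rightCont hV hC hWG s t
  rw [real_inner_Lp_eq_integral_mul]
  refine Eq.trans (integral_congr_ae ?_) (h1.trans (intervalIntegral.integral_congr fun r _ => ?_))
  · filter_upwards [coeFn_mulOp (h.memLp_top_pathIntegral hV hC s t) G] with ω hω
    rw [hω]
    ring
  · rw [real_inner_Lp_eq_integral_mul]
    refine integral_congr_ae ?_
    filter_upwards [coeFn_mulOp (h.memLp_top_comp hV hC r.toNNReal) G] with ω hω
    rw [hω]
    ring

omit [TopologicalSpace E] [TopologicalSpace.PseudoMetrizableSpace E] [MeasurableSpace E]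
  [BorelSpace E] in
theorem aestronglyMeasurable_mulOp {t : ℝ≥0} {Z : Ω → ℝ} (hZ : MemLp Z ∞ Pr)
    (hZm : Measurable[ℱ t] Z) {W : Lp ℝ 2 Pr} (hW : AEStronglyMeasurable[ℱ t] W Pr) :
    AEStronglyMeasurable[ℱ t] (mulOp hZ W) Pr :=
  (hZm.stronglyMeasurable.aestronglyMeasurable.mul hW).congr (coeFn_mulOp hZ W).symm

omit [TopologicalSpace.PseudoMetrizableSpace E] [BorelSpace E] in
theorem aestronglyMeasurable_J (h : IsStationaryMarkov ℱ X Pr μ) (t : ℝ≥0) (g : Lp ℝ 2 μ) :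
    AEStronglyMeasurable[ℱ t] (h.J t g) Pr :=
  ((Lp.stronglyMeasurable g).comp_measurable (h.adapted t)).aestronglyMeasurable.congr
    (coeFn_compOp (h.mp t) g).symm

omit [TopologicalSpace.PseudoMetrizableSpace E] [BorelSpace E] in
/-- The two-time Markov property: conditioning first at the time `s + r`, then at the time `s`. -/
theorem inner_mulOp_comp_J (h : IsStationaryMarkov ℱ X Pr μ) (hV : Measurable V)
    (hC : ∀ x, |V x| ≤ C) (s : ℝ≥0) {r δ : ℝ≥0} (hr : r ≤ δ) {W : Lp ℝ 2 Pr}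
    (hW : AEStronglyMeasurable[ℱ s] W Pr) (g : Lp ℝ 2 μ) :
    inner ℝ W (mulOp (h.memLp_top_comp hV hC (s + r)) (h.J (s + δ) g))
      = inner ℝ ((h.J s).adjoint W) ((h.J 0).adjoint (h.J r
        (mulOp (memLp_top_of_bound hV.aestronglyMeasurable C (ae_of_all μ fun x => hC x))
          ((h.J 0).adjoint (h.J (δ - r) g))))) := by
  have hδ : s + δ = s + r + (δ - r) := by rw [add_assoc, add_tsub_cancel_of_le hr]
  have hWr : AEStronglyMeasurable[ℱ (s + r)] (mulOp (h.memLp_top_comp hV hC (s + r)) W) Pr :=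
    aestronglyMeasurable_mulOp _ (hV.comp (h.adapted _)) (hW.mono (ℱ.mono le_self_add))
  rw [← inner_mulOp_left, hδ, h.markov (s + r) (δ - r) _ g hWr, inner_mulOp_left,
    ← compOp_mulOp (h.mp (s + r)) (memLp_top_of_bound hV.aestronglyMeasurable C
      (ae_of_all μ fun x => hC x)), h.markov s r W _ hW, ContinuousLinearMap.adjoint_inner_left]

/-- A step of length `δ` started at time `s` has the same effect as one started at time `0`. -/
theorem inner_eulerOp [IsProbabilityMeasure Pr] (h : IsStationaryMarkov ℱ X Pr μ)
    (hV : Measurable V) (hC : ∀ x, |V x| ≤ C) (s δ : ℝ≥0) {W : Lp ℝ 2 Pr}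
    (hW : AEStronglyMeasurable[ℱ s] W Pr) (g : Lp ℝ 2 μ) :
    inner ℝ W (h.J (s + δ) g + mulOp (h.memLp_top_pathIntegral hV hC s (s + δ)) (h.J (s + δ) g))
      = inner ℝ W (h.J s (h.eulerOp hV hC δ g)) := by
  have hJ : inner ℝ W (h.J (s + δ) g) = inner ℝ (h.J 0 ((h.J s).adjoint W)) (h.J δ g) := by
    rw [h.markov s δ W g hW, ← ContinuousLinearMap.adjoint_inner_left,
      ContinuousLinearMap.adjoint_inner_right]
  rw [← ContinuousLinearMap.adjoint_inner_left, eulerOp, ContinuousLinearMap.comp_apply,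
    ContinuousLinearMap.adjoint_inner_right, add_apply,
    ContinuousLinearMap.comp_apply, inner_add_right, inner_add_right, hJ,
    h.inner_mulOp_pathIntegral hV hC, h.inner_mulOp_pathIntegral hV hC]
  congr 1
  have hshift := intervalIntegral.integral_comp_add_right (a := 0) (b := (δ : ℝ))
    (fun r => inner ℝ W (mulOp (h.memLp_top_comp hV hC r.toNNReal) (h.J (s + δ) g))) (s : ℝ)
  rw [zero_add, add_comm (δ : ℝ)] at hshift
  rw [NNReal.coe_add, ← hshift, NNReal.coe_zero]
  refine intervalIntegral.integral_congr fun r hr => ?_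
  rw [Set.uIcc_of_le (NNReal.coe_nonneg δ)] at hr
  have hr' : r.toNNReal ≤ δ := Real.toNNReal_le_iff_le_coe.2 hr.2
  have h1 : (r + (s : ℝ)).toNNReal = s + r.toNNReal := by
    rw [Real.toNNReal_add hr.1 (NNReal.coe_nonneg s), Real.toNNReal_coe, add_comm]
  have h2 := h.inner_mulOp_comp_J hV hC 0 hr' (h.aestronglyMeasurable_J 0 ((h.J s).adjoint W)) g
  simp only [zero_add, adjoint_compOp_compOp] at h2
  have h3 := h.inner_mulOp_comp_J hV hC s hr' hW g
  simp only [h1]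
  rw [h3, h2]

theorem weightOp_weightOp (h : IsStationaryMarkov ℱ X Pr μ) (hV : Measurable V)
    (hC : ∀ x, |V x| ≤ C) (r s t : ℝ≥0) (W : Lp ℝ 2 Pr) :
    h.weightOp hV hC s t (h.weightOp hV hC r s W) = h.weightOp hV hC r t W := by
  ext1
  filter_upwards [coeFn_mulOp (h.memLp_top_exp hV hC s t) (h.weightOp hV hC r s W),
    coeFn_mulOp (h.memLp_top_exp hV hC r s) W, coeFn_mulOp (h.memLp_top_exp hV hC r t) W]
    with ω h1 h2 h3
  rw [h1, h2, h3, ← pathIntegral_add h.measurable h.rightCont hV hC r s t ω, Real.exp_add]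
  ring

theorem norm_weightOp_le (h : IsStationaryMarkov ℱ X Pr μ) (hV : Measurable V)
    (hC : ∀ x, |V x| ≤ C) (s δ : ℝ≥0) (W : Lp ℝ 2 Pr) :
    ‖h.weightOp hV hC s (s + δ) W‖ ≤ Real.exp (C * δ) * ‖W‖ :=
  norm_mulOp_apply_le _ (fun ω => by
    rw [Real.abs_exp]
    refine Real.exp_le_exp.2 ((le_abs_self _).trans ((abs_pathIntegral_le hC _ _ ω).trans_eq ?_))
    simp) W

theorem norm_mulOp_pathIntegral_le (h : IsStationaryMarkov ℱ X Pr μ) (hV : Measurable V)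
    (hC : ∀ x, |V x| ≤ C) (s δ : ℝ≥0) (W : Lp ℝ 2 Pr) :
    ‖mulOp (h.memLp_top_pathIntegral hV hC s (s + δ)) W‖ ≤ C * δ * ‖W‖ :=
  norm_mulOp_apply_le _ (fun ω => (abs_pathIntegral_le hC _ _ ω).trans_eq (by simp)) W

theorem norm_weightOp_sub_le (h : IsStationaryMarkov ℱ X Pr μ) (hV : Measurable V)
    (hC : ∀ x, |V x| ≤ C) (s : ℝ≥0) {δ : ℝ≥0} (hδ : (C : ℝ) * δ ≤ 1) (W : Lp ℝ 2 Pr) :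
    ‖h.weightOp hV hC s (s + δ) W - W - mulOp (h.memLp_top_pathIntegral hV hC s (s + δ)) W‖
      ≤ (C * δ) ^ 2 * ‖W‖ := by
  refine Lp.norm_le_mul_norm_of_ae_le_mul ?_
  filter_upwards [coeFn_mulOp (h.memLp_top_exp hV hC s (s + δ)) W,
    coeFn_mulOp (h.memLp_top_pathIntegral hV hC s (s + δ)) W,
    Lp.coeFn_sub (h.weightOp hV hC s (s + δ) W - W)
      (mulOp (h.memLp_top_pathIntegral hV hC s (s + δ)) W),
    Lp.coeFn_sub (h.weightOp hV hC s (s + δ) W) W] with ω h1 h2 h3 h4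
  rw [h3, Pi.sub_apply, h4, Pi.sub_apply, h1, h2]
  have hI : |pathIntegral X V s (s + δ) ω| ≤ C * δ :=
    (abs_pathIntegral_le hC _ _ ω).trans_eq (by simp)
  have hexp := Real.abs_exp_sub_one_sub_id_le (hI.trans hδ)
  have hfac : ∀ a b w : ℝ, a * w - w - b * w = (a - 1 - b) * w := fun a b w => by ring
  rw [hfac, norm_mul]
  refine mul_le_mul_of_nonneg_right (hexp.trans ?_) (norm_nonneg _)
  rw [← sq_abs]
  gcongr

/-- Over a grid of mesh `δ` the exponential weight is approximated, in operator norm, by a weight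
for which the Markov property holds exactly, with the iterates of `eulerOp` as transitions. -/
theorem exists_gridWeight [IsProbabilityMeasure Pr] (h : IsStationaryMarkov ℱ X Pr μ)
    (hV : Measurable V) (hC : ∀ x, |V x| ≤ C) (s : ℝ≥0) {δ : ℝ≥0} (hδ : (C : ℝ) * δ ≤ 1)
    {W : Lp ℝ 2 Pr} (hW : AEStronglyMeasurable[ℱ s] W Pr) (n : ℕ) :
    ∃ W' : Lp ℝ 2 Pr, AEStronglyMeasurable[ℱ (s + n * δ)] W' Pr ∧
      (∀ g, inner ℝ W' (h.J (s + n * δ) g) = inner ℝ W (h.J s ((h.eulerOp hV hC δ ^ n) g))) ∧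
      ‖W' - h.weightOp hV hC s (s + n * δ) W‖
        ≤ n * (C * δ) ^ 2 * Real.exp (n * (C * δ)) * ‖W‖ := by
  induction n with
  | zero =>
    have hs : s + ((0 : ℕ) : ℝ≥0) * δ = s := by simp
    rw [hs]
    refine ⟨W, hW, by simp, ?_⟩
    have h0 : h.weightOp hV hC s s W = W := by
      ext1
      filter_upwards [coeFn_mulOp (h.memLp_top_exp hV hC s s) W] with ω h1
      rw [h1]
      simp [pathIntegral]
    simp [h0]
  | succ n ih =>
    obtain ⟨W', hm, hW', hn⟩ := ih
    have ht : s + ((n + 1 : ℕ) : ℝ≥0) * δ = s + n * δ + δ := by push_cast; ring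
    rw [ht]
    generalize hu : s + (n : ℝ≥0) * δ = u at hm hW' hn ⊢
    refine ⟨W' + mulOp (h.memLp_top_pathIntegral hV hC u (u + δ)) W', ?_, fun g => ?_, ?_⟩
    · have hm' : AEStronglyMeasurable[ℱ (u + δ)] W' Pr := hm.mono (ℱ.mono le_self_add)
      exact (hm'.add (aestronglyMeasurable_mulOp _
        (h.measurable_pathIntegral_filtration hV le_self_add) hm')).congr (Lp.coeFn_add _ _).symm
    · rw [inner_add_left, inner_mulOp_left, ← inner_add_right, h.inner_eulerOp hV hC u δ hm, hW',
        pow_succ, mul_apply_eq_comp]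
    · set Y := h.weightOp hV hC s u W with hY
      set M := mulOp (h.memLp_top_pathIntegral hV hC u (u + δ)) with hM
      set ε : ℝ := C * δ with hε
      have hε0 : 0 ≤ ε := by positivity
      have hYn : ‖Y‖ ≤ Real.exp (n * ε) * ‖W‖ := by
        have := h.norm_weightOp_le hV hC s (n * δ) W
        rw [hu] at this
        refine this.trans_eq ?_
        rw [hε]
        push_cast
        ring_nf
      have hD : ‖(W' - Y) + M (W' - Y)‖ ≤ Real.exp ε * ‖W' - Y‖ := by
        refine (norm_add_le _ _).trans ?_
        have h1 : ‖M (W' - Y)‖ ≤ ε * ‖W' - Y‖ := h.norm_mulOp_pathIntegral_le hV hC u δ _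
        have h2 := mul_le_mul_of_nonneg_right (Real.add_one_le_exp ε) (norm_nonneg (W' - Y))
        linarith
      have hR : ‖h.weightOp hV hC u (u + δ) Y - Y - M Y‖ ≤ ε ^ 2 * ‖Y‖ :=
        h.norm_weightOp_sub_le hV hC u hδ Y
      have hsplit : W' + M W' - h.weightOp hV hC s (u + δ) W
          = ((W' - Y) + M (W' - Y)) - (h.weightOp hV hC u (u + δ) Y - Y - M Y) := by
        rw [← h.weightOp_weightOp hV hC s u (u + δ) W, ← hY, map_sub]
        abel
      rw [hsplit]
      have hexp : Real.exp ((n + 1 : ℕ) * ε) = Real.exp ε * Real.exp (n * ε) := by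
        rw [← Real.exp_add]; congr 1; push_cast; ring
      calc _ ≤ Real.exp ε * ‖W' - Y‖ + ε ^ 2 * ‖Y‖ := (norm_sub_le _ _).trans (add_le_add hD hR)
        _ ≤ Real.exp ε * (n * ε ^ 2 * Real.exp (n * ε) * ‖W‖)
            + ε ^ 2 * (Real.exp ε * (Real.exp (n * ε) * ‖W‖)) := by
          gcongr
          refine hYn.trans (le_mul_of_one_le_left (by positivity) (Real.one_le_exp hε0))
        _ = _ := by rw [hexp]; push_cast; ring

/-- The Markov property for the additive functional: conditionally on the past of `s`, the weighted
evaluation at time `s + t` is the Feynman-Kac operator evaluated at `X_s`. -/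
theorem inner_weightOp [IsProbabilityMeasure Pr] (h : IsStationaryMarkov ℱ X Pr μ)
    (hV : Measurable V) (hC : ∀ x, |V x| ≤ C) (s t : ℝ≥0) {W : Lp ℝ 2 Pr}
    (hW : AEStronglyMeasurable[ℱ s] W Pr) (g : Lp ℝ 2 μ) :
    inner ℝ (h.weightOp hV hC s (s + t) W) (h.J (s + t) g)
      = inner ℝ W (h.J s (h.fkOp hV hC t g)) := by
  -- The right-hand side is the left-hand side for `s = 0` and `W` replaced by `J_0 k`; since
  -- `J_0† J_0 k = k`, both are limits of the same sequence of Euler approximations.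
  set k := (h.J s).adjoint W with hk
  have hfk : inner ℝ W (h.J s (h.fkOp hV hC t g))
      = inner ℝ (h.weightOp hV hC 0 (0 + t) (h.J 0 k)) (h.J (0 + t) g) := by
    rw [← ContinuousLinearMap.adjoint_inner_left, fkOp, ContinuousLinearMap.comp_apply,
      ContinuousLinearMap.adjoint_inner_right, inner_mulOp_left, zero_add]
    rfl
  rw [hfk]
  have hgrid : ∀ (u : ℝ≥0) (U : Lp ℝ 2 Pr), AEStronglyMeasurable[ℱ u] U Pr →
      (h.J u).adjoint U = k → ∀ n : ℕ, n ≠ 0 → (C : ℝ) * t ≤ n →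
      |inner ℝ (h.weightOp hV hC u (u + t) U) (h.J (u + t) g)
          - inner ℝ k ((h.eulerOp hV hC (t / n) ^ n) g)|
        ≤ (C * t) ^ 2 * Real.exp (C * t) * ‖U‖ * ‖g‖ / n := by
    intro u U hU hUk n hn hCn
    have hn' : (0 : ℝ) < n := by positivity
    have hδ : (C : ℝ) * (t / n : ℝ≥0) ≤ 1 := by
      push_cast
      rw [← mul_div_assoc, div_le_one hn']
      exact hCn
    -- The weighted evaluation is compared with `⟪k, (eulerOp)ⁿ g⟫`, which depends on `U` only
    -- through `k`.
    obtain ⟨U', -, hU', hle⟩ := h.exists_gridWeight hV hC u hδ hU n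
    have hnt : (n : ℝ≥0) * (t / n) = t := mul_div_cancel₀ _ (by exact_mod_cast hn)
    rw [hnt] at hU' hle
    rw [← hUk, ContinuousLinearMap.adjoint_inner_left, ← hU', ← inner_sub_left]
    refine (abs_real_inner_le_norm _ _).trans ?_
    rw [norm_compOp, norm_sub_rev]
    refine (mul_le_mul_of_nonneg_right hle (norm_nonneg g)).trans_eq ?_
    push_cast
    have h1 : (n : ℝ) * (C * (t / n)) = C * t := by field_simp
    rw [h1]
    field_simp
  have hlim : ∀ (u : ℝ≥0) (U : Lp ℝ 2 Pr), AEStronglyMeasurable[ℱ u] U Pr →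
      (h.J u).adjoint U = k →
      Tendsto (fun n : ℕ => inner ℝ k ((h.eulerOp hV hC (t / n) ^ n) g)) atTop
        (𝓝 (inner ℝ (h.weightOp hV hC u (u + t) U) (h.J (u + t) g))) := by
    intro u U hU hUk
    rw [tendsto_iff_norm_sub_tendsto_zero]
    refine squeeze_zero' (Eventually.of_forall fun _ => norm_nonneg _) ?_
      (tendsto_const_div_atTop_nhds_zero_nat ((C * t) ^ 2 * Real.exp (C * t) * ‖U‖ * ‖g‖))
    filter_upwards [eventually_ge_atTop ⌈(C : ℝ) * t⌉₊, eventually_ne_atTop 0] with n hn1 hn0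
    rw [norm_sub_rev]
    exact hgrid u U hU hUk n hn0 (Nat.ceil_le.1 hn1)
  exact tendsto_nhds_unique (hlim s W hW rfl)
    (hlim 0 (h.J 0 k) (h.aestronglyMeasurable_J 0 k) (adjoint_compOp_compOp (h.mp 0) k))

/-- The Feynman-Kac operators form a semigroup. -/
theorem fkOp_add [IsProbabilityMeasure Pr] (h : IsStationaryMarkov ℱ X Pr μ)
    (hV : Measurable V) (hC : ∀ x, |V x| ≤ C) (s t : ℝ≥0) (g : Lp ℝ 2 μ) :
    h.fkOp hV hC (s + t) g = h.fkOp hV hC s (h.fkOp hV hC t g) := by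
  refine ext_inner_left ℝ fun k => ?_
  have hm : AEStronglyMeasurable[ℱ s] (h.weightOp hV hC 0 s (h.J 0 k)) Pr :=
    aestronglyMeasurable_mulOp _ (h.measurable_pathIntegral_filtration hV zero_le).exp
      ((h.aestronglyMeasurable_J 0 k).mono (ℱ.mono zero_le))
  have h1 := h.inner_weightOp hV hC s t hm g
  rw [h.weightOp_weightOp] at h1
  have h2 : ∀ (r : ℝ≥0) (f : Lp ℝ 2 μ), inner ℝ k (h.fkOp hV hC r f)
      = inner ℝ (h.weightOp hV hC 0 r (h.J 0 k)) (h.J r f) := fun r f => by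
    rw [fkOp, ContinuousLinearMap.comp_apply, ContinuousLinearMap.adjoint_inner_right,
      inner_mulOp_left]
    rfl
  rw [h2, h2, h1]

/-! ### Short-time asymptotics -/

/-- Right continuity of the paths makes `g ∘ X_r → g ∘ X_0` in `L²`: clear for bounded continuous
`g` by dominated convergence, and these are dense. -/
theorem tendsto_J_zero [IsProbabilityMeasure Pr] [IsProbabilityMeasure μ]
    (h : IsStationaryMarkov ℱ X Pr μ) (g : Lp ℝ 2 μ) :
    Tendsto (fun r => h.J r g) (𝓝 0) (𝓝 (h.J 0 g)) := by
  have hbc : ∀ φ : BoundedContinuousFunction E ℝ,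
      Tendsto (fun r => h.J r (φ.toLp 2 μ ℝ)) (𝓝 0) (𝓝 (h.J 0 (φ.toLp 2 μ ℝ))) := by
    intro φ
    rw [tendsto_iff_norm_sub_tendsto_zero]
    have hJφ : ∀ r, h.J r (φ.toLp 2 μ ℝ) =ᵐ[Pr] fun ω => φ (X r ω) := fun r => by
      filter_upwards [coeFn_compOp (h.mp r) (φ.toLp 2 μ ℝ),
        (h.mp r).quasiMeasurePreserving.ae (φ.coeFn_toLp μ (p := 2) (𝕜 := ℝ))] with ω h1 h2
      rw [h1, h2]
    have hsq : ∀ r, ‖h.J r (φ.toLp 2 μ ℝ) - h.J 0 (φ.toLp 2 μ ℝ)‖ ^ 2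
        = ∫ ω, (φ (X r ω) - φ (X 0 ω)) ^ 2 ∂Pr := fun r => by
      rw [← real_inner_self_eq_norm_sq, real_inner_Lp_eq_integral_mul]
      refine integral_congr_ae ?_
      filter_upwards [hJφ r, hJφ 0, Lp.coeFn_sub (h.J r (φ.toLp 2 μ ℝ)) (h.J 0 (φ.toLp 2 μ ℝ))]
        with ω h1 h2 h3
      rw [h3, Pi.sub_apply, h1, h2, sq]
    have hlim : Tendsto (fun r => ∫ ω, (φ (X r ω) - φ (X 0 ω)) ^ 2 ∂Pr) (𝓝 0)
        (𝓝 (∫ _, (0 : ℝ) ∂Pr)) := by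
      refine tendsto_integral_filter_of_dominated_convergence (fun _ => (2 * ‖φ‖) ^ 2)
        (Eventually.of_forall fun r => ?_) (Eventually.of_forall fun r => ae_of_all _ fun ω => ?_)
        (integrable_const _) (ae_of_all _ fun ω => ?_)
      · exact (((φ.continuous.measurable.comp (h.measurable r)).sub
          (φ.continuous.measurable.comp (h.measurable 0))).pow_const 2).aestronglyMeasurable
      · rw [norm_pow]
        gcongr
        exact φ.dist_le_two_norm _ _
      · have h0 := h.rightCont ω 0
        have huniv : Set.Ici (0 : ℝ≥0) = Set.univ := Set.Ici_bot
        rw [huniv, continuousWithinAt_univ] at h0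
        have h1 : Tendsto (fun r => (φ (X r ω) - φ (X 0 ω)) ^ 2) (𝓝 0)
            (𝓝 ((φ (X 0 ω) - φ (X 0 ω)) ^ 2)) :=
          (((φ.continuous.tendsto _).comp h0).sub_const _).pow 2
        simpa using h1
    rw [integral_zero] at hlim
    have h2 := hlim.sqrt
    simp only [← hsq, Real.sqrt_zero, Real.sqrt_sq (norm_nonneg _)] at h2
    exact h2
  rw [Metric.tendsto_nhds]
  intro ε hε
  obtain ⟨φ, hφ⟩ := (BoundedContinuousFunction.toLp_denseRange ℝ μ ℝ
    (p := 2) ENNReal.ofNat_ne_top).exists_dist_lt g (show 0 < ε / 3 by positivity)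
  have h1 : ∀ r, dist (h.J r g) (h.J r (φ.toLp 2 μ ℝ)) < ε / 3 := fun r => by
    rw [dist_eq_norm, ← map_sub, norm_compOp, ← dist_eq_norm]
    exact hφ
  filter_upwards [Metric.tendsto_nhds.1 (hbc φ) (ε / 3) (by positivity)] with r hr
  calc dist (h.J r g) (h.J 0 g)
      ≤ dist (h.J r g) (h.J r (φ.toLp 2 μ ℝ)) + dist (h.J r (φ.toLp 2 μ ℝ)) (h.J 0 (φ.toLp 2 μ ℝ))
        + dist (h.J 0 (φ.toLp 2 μ ℝ)) (h.J 0 g) := dist_triangle4 _ _ _ _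
    _ < ε / 3 + ε / 3 + ε / 3 := by
        have := h1 r
        have := h1 0
        rw [dist_comm] at this
        linarith
    _ = ε := by ring

/-- Averages over a short time interval inherit bounds that hold at all times of the interval. -/
theorem norm_mulOp_pathIntegral_sub_smul_le [IsProbabilityMeasure Pr]
    (h : IsStationaryMarkov ℱ X Pr μ) (hV : Measurable V) (hC : ∀ x, |V x| ≤ C) (δ : ℝ≥0)
    (G Z : Lp ℝ 2 Pr) {ε : ℝ}
    (hε : ∀ r ≤ δ, ‖mulOp (h.memLp_top_comp hV hC r) G - Z‖ ≤ ε) :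
    ‖mulOp (h.memLp_top_pathIntegral hV hC 0 δ) G - (δ : ℝ) • Z‖ ≤ δ * ε := by
  set D := mulOp (h.memLp_top_pathIntegral hV hC 0 δ) G - (δ : ℝ) • Z with hD
  have hε0 : 0 ≤ ε := (norm_nonneg _).trans (hε 0 zero_le)
  have hint : IntervalIntegrable
      (fun r : ℝ => inner ℝ D (mulOp (h.memLp_top_comp hV hC r.toNNReal) G)) volume 0 δ := by
    have h1 := (integrable_prod_comp_path_mul h.measurable h.rightCont hV hC
      ((Lp.memLp D).integrable_mul (Lp.memLp G)) 0 δ).integral_prod_left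
    rw [intervalIntegrable_iff]
    refine h1.congr (ae_of_all _ fun r => ?_)
    beta_reduce
    rw [real_inner_Lp_eq_integral_mul]
    refine integral_congr_ae ?_
    filter_upwards [coeFn_mulOp (h.memLp_top_comp hV hC r.toNNReal) G] with ω hω
    rw [hω, Pi.mul_apply]
    ring
  have hsq : ‖D‖ ^ 2 = ∫ r in (0 : ℝ)..δ,
      inner ℝ D (mulOp (h.memLp_top_comp hV hC r.toNNReal) G - Z) := by
    simp only [inner_sub_right]
    rw [intervalIntegral.integral_sub hint intervalIntegrable_const,
      intervalIntegral.integral_const, ← NNReal.coe_zero, ← h.inner_mulOp_pathIntegral hV hC 0 δ D G,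
      NNReal.coe_zero, sub_zero, smul_eq_mul, ← real_inner_smul_right, ← inner_sub_right, ← hD,
      real_inner_self_eq_norm_sq]
  have hle : ‖D‖ ^ 2 ≤ ‖D‖ * ε * δ := by
    rw [hsq]
    have hb := intervalIntegral.norm_integral_le_of_norm_le_const (a := (0 : ℝ)) (b := δ)
      (f := fun r : ℝ => inner ℝ D (mulOp (h.memLp_top_comp hV hC r.toNNReal) G - Z))
      (C := ‖D‖ * ε) fun r hr => by
        rw [Set.uIoc_of_le (NNReal.coe_nonneg δ)] at hr
        exact (norm_inner_le_norm _ _).trans (mul_le_mul_of_nonneg_left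
          (hε _ (Real.toNNReal_le_iff_le_coe.2 hr.2)) (norm_nonneg _))
    rw [sub_zero, NNReal.abs_eq] at hb
    exact (le_abs_self _).trans hb
  rcases (norm_nonneg D).eq_or_lt with h0 | h0
  · rw [← h0]
    positivity
  · have : ‖D‖ * ‖D‖ ≤ ‖D‖ * (δ * ε) := by rw [← sq]; linarith
    exact le_of_mul_le_mul_left this h0

/-- The bounded operator of multiplication by `V` on `L²(μ)`. -/
noncomputable abbrev potOp (μ : Measure E) (hV : Measurable V) (hC : ∀ x, |V x| ≤ C) :
    Lp ℝ 2 μ →L[ℝ] Lp ℝ 2 μ :=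
  mulOp (memLp_top_of_bound hV.aestronglyMeasurable C (ae_of_all μ fun x => hC x))

/-- The Feynman-Kac semigroup and the transition semigroup differ by `V` to first order. -/
theorem tendsto_fkOp_sub_div [IsProbabilityMeasure Pr] [IsProbabilityMeasure μ]
    (h : IsStationaryMarkov ℱ X Pr μ) (hV : Measurable V) (hC : ∀ x, |V x| ≤ C) (g : Lp ℝ 2 μ) :
    Tendsto (fun δ : ℝ≥0 => (δ : ℝ)⁻¹ • (h.fkOp hV hC δ g - (h.J 0).adjoint (h.J δ g)))
      (𝓝[>] 0) (𝓝 (potOp μ hV hC g)) := by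
  set Vg := potOp μ hV hC g with hVg
  have hmod : ∀ ε > 0, ∃ η > (0 : ℝ≥0), ∀ r < η, ‖h.J r g - h.J 0 g‖ < ε ∧
      ‖h.J r Vg - h.J 0 Vg‖ < ε := by
    intro ε hε
    have h1 := (Metric.tendsto_nhds.1 (h.tendsto_J_zero g) ε hε).and
      (Metric.tendsto_nhds.1 (h.tendsto_J_zero Vg) ε hε)
    obtain ⟨η, hη, hη'⟩ := NNReal.nhds_zero_basis.eventually_iff.1 h1
    exact ⟨η, hη, fun r hr => by simpa only [dist_eq_norm] using hη' hr⟩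
  have hbound : ∀ (δ : ℝ≥0) (ε : ℝ), 0 < δ → (C : ℝ) * δ ≤ 1 →
      (∀ r ≤ δ, ‖h.J r g - h.J 0 g‖ < ε ∧ ‖h.J r Vg - h.J 0 Vg‖ < ε) →
      ‖(δ : ℝ)⁻¹ • (h.fkOp hV hC δ g - (h.J 0).adjoint (h.J δ g)) - Vg‖
        ≤ C ^ 2 * δ * ‖g‖ + (2 * C + 1) * ε := by
    intro δ ε hδ hCδ hr
    have hδ' : (0 : ℝ) < δ := hδ
    have h1 := h.norm_weightOp_sub_le hV hC 0 (by simpa using hCδ) (h.J δ g)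
    have h2 : ‖mulOp (h.memLp_top_pathIntegral hV hC 0 δ) (h.J δ g) - (δ : ℝ) • h.J 0 Vg‖
        ≤ δ * ((2 * C + 1) * ε) := by
      refine h.norm_mulOp_pathIntegral_sub_smul_le hV hC δ _ _ fun r hrδ => ?_
      -- `J_r (V g) = V(X_r) J_r g`, so only increments of `J g` and `J (V g)` remain.
      have hsplit : mulOp (h.memLp_top_comp hV hC r) (h.J δ g) - h.J 0 Vg
          = mulOp (h.memLp_top_comp hV hC r) ((h.J δ g - h.J 0 g) - (h.J r g - h.J 0 g))
            + (h.J r Vg - h.J 0 Vg) := by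
        rw [hVg, potOp, compOp_mulOp (h.mp r) _ (h.memLp_top_comp hV hC r), map_sub, map_sub,
          map_sub]
        abel
      rw [hsplit]
      have h3 := norm_mulOp_apply_le (h.memLp_top_comp hV hC r) (fun ω => hC _)
        ((h.J δ g - h.J 0 g) - (h.J r g - h.J 0 g))
      have h4 := norm_sub_le (h.J δ g - h.J 0 g) (h.J r g - h.J 0 g)
      have h5 := (hr δ le_rfl).1
      have h6 := hr r hrδ
      calc _ ≤ C * (ε + ε) + ε :=
            (norm_add_le _ _).trans (add_le_add (h3.trans (by gcongr; linarith)) h6.2.le)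
        _ = _ := by ring
    have hsplit : (δ : ℝ)⁻¹ • (h.fkOp hV hC δ g - (h.J 0).adjoint (h.J δ g)) - Vg
        = (δ : ℝ)⁻¹ • (h.J 0).adjoint
          ((h.weightOp hV hC 0 δ (h.J δ g) - h.J δ g
            - mulOp (h.memLp_top_pathIntegral hV hC 0 δ) (h.J δ g))
          + (mulOp (h.memLp_top_pathIntegral hV hC 0 δ) (h.J δ g) - (δ : ℝ) • h.J 0 Vg)) := by
      have h3 : (δ : ℝ)⁻¹ • (δ : ℝ) • Vg = Vg := inv_smul_smul₀ hδ'.ne' Vg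
      conv_lhs => rw [← h3]
      rw [← smul_sub, sub_add_sub_cancel, map_sub, map_sub, map_smul, adjoint_compOp_compOp]
      rfl
    rw [hsplit, norm_smul, norm_inv, Real.norm_of_nonneg hδ'.le, inv_mul_le_iff₀ hδ']
    rw [zero_add, norm_compOp] at h1
    calc _ ≤ (C * δ) ^ 2 * ‖g‖ + δ * ((2 * C + 1) * ε) :=
          (norm_adjoint_compOp_le _ _).trans ((norm_add_le _ _).trans (add_le_add h1 h2))
      _ = _ := by ring
  rw [Metric.tendsto_nhds]
  intro ε hε
  obtain ⟨η, hη, hη'⟩ := hmod (ε / (2 * (2 * C + 1))) (by positivity)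
  have hlim1 : Tendsto (fun δ : ℝ≥0 => (C : ℝ) ^ 2 * δ * ‖g‖) (𝓝[>] 0) (𝓝 0) := by
    have : Continuous fun δ : ℝ≥0 => (C : ℝ) ^ 2 * δ * ‖g‖ := by fun_prop
    simpa using (this.tendsto 0).mono_left nhdsWithin_le_nhds
  have hlim2 : Tendsto (fun δ : ℝ≥0 => (C : ℝ) * δ) (𝓝[>] 0) (𝓝 0) := by
    have : Continuous fun δ : ℝ≥0 => (C : ℝ) * δ := by fun_prop
    simpa using (this.tendsto 0).mono_left nhdsWithin_le_nhds
  filter_upwards [self_mem_nhdsWithin, hlim1.eventually (gt_mem_nhds (half_pos hε)),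
    hlim2.eventually (ge_mem_nhds zero_lt_one), nhdsWithin_le_nhds (gt_mem_nhds hη)]
    with δ h1 h2 h3 h4
  rw [dist_eq_norm]
  have h5 := hbound δ _ h1 h3 fun r hr => hη' r (hr.trans_lt h4)
  have h6 : (2 * (C : ℝ) + 1) * (ε / (2 * (2 * C + 1))) = ε / 2 := by field_simp
  rw [h6] at h5
  linarith

/-! ### The energy estimate -/

omit [TopologicalSpace.PseudoMetrizableSpace E] [BorelSpace E] in
theorem J_const [IsProbabilityMeasure Pr] [IsProbabilityMeasure μ]
    (h : IsStationaryMarkov ℱ X Pr μ) (t : ℝ≥0) (c : ℝ) :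
    h.J t (Lp.const 2 μ c) = Lp.const 2 Pr c := by
  ext1
  filter_upwards [coeFn_compOp (h.mp t) (Lp.const 2 μ c), Lp.coeFn_const (p := 2) (μ := Pr) c,
    (h.mp t).quasiMeasurePreserving.ae (Lp.coeFn_const (p := 2) (μ := μ) c)] with ω h1 h2 h3
  rw [h1, h2, h3]
  rfl

theorem fkOp_apply (h : IsStationaryMarkov ℱ X Pr μ) (hV : Measurable V)
    (hC : ∀ x, |V x| ≤ C) (t : ℝ≥0) (g : Lp ℝ 2 μ) :
    h.fkOp hV hC t g = (h.J 0).adjoint (h.weightOp hV hC 0 t (h.J t g)) := rfl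

theorem norm_fkOp_le (h : IsStationaryMarkov ℱ X Pr μ) (hV : Measurable V)
    (hC : ∀ x, |V x| ≤ C) (t : ℝ≥0) (g : Lp ℝ 2 μ) :
    ‖h.fkOp hV hC t g‖ ≤ Real.exp (C * t) * ‖g‖ := by
  have h1 := h.norm_weightOp_le hV hC 0 t (h.J t g)
  rw [zero_add, norm_compOp] at h1
  rw [h.fkOp_apply]
  exact (norm_adjoint_compOp_le _ _).trans h1

theorem fkOp_zero (h : IsStationaryMarkov ℱ X Pr μ) (hV : Measurable V)
    (hC : ∀ x, |V x| ≤ C) (g : Lp ℝ 2 μ) : h.fkOp hV hC 0 g = g := by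
  have h0 : h.weightOp hV hC 0 0 (h.J 0 g) = h.J 0 g := by
    ext1
    filter_upwards [coeFn_mulOp (h.memLp_top_exp hV hC 0 0) (h.J 0 g)] with ω h1
    rw [h1]
    simp [pathIntegral]
  rw [h.fkOp_apply, h0, adjoint_compOp_compOp]

/-- The function `u(t, x) = E^x[exp (∫₀ᵗ V(X_r) dr)]` as an element of `L²(μ)`. -/
noncomputable def fkOne [IsProbabilityMeasure μ] (h : IsStationaryMarkov ℱ X Pr μ)
    (hV : Measurable V) (hC : ∀ x, |V x| ≤ C) (t : ℝ≥0) : Lp ℝ 2 μ :=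
  h.fkOp hV hC t (Lp.const 2 μ 1)

variable [IsProbabilityMeasure Pr] [IsProbabilityMeasure μ]

omit [TopologicalSpace.PseudoMetrizableSpace E] [BorelSpace E] in
theorem adjoint_J_const (h : IsStationaryMarkov ℱ X Pr μ) (c : ℝ) :
    (h.J 0).adjoint (Lp.const 2 Pr c) = Lp.const 2 μ c := by
  rw [← h.J_const 0, adjoint_compOp_compOp]

theorem tendsto_fkOne_sub_one (h : IsStationaryMarkov ℱ X Pr μ) (hV : Measurable V)
    (hC : ∀ x, |V x| ≤ C) :
    Tendsto (fun δ : ℝ≥0 => (δ : ℝ)⁻¹ • (h.fkOne hV hC δ - Lp.const 2 μ 1)) (𝓝[>] 0)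
      (𝓝 (potOp μ hV hC (Lp.const 2 μ 1))) := by
  refine (h.tendsto_fkOp_sub_div hV hC (Lp.const 2 μ 1)).congr fun δ => ?_
  rw [h.J_const, h.adjoint_J_const, fkOne]

theorem tendsto_fkOne_slope (h : IsStationaryMarkov ℱ X Pr μ) (hV : Measurable V)
    (hC : ∀ x, |V x| ≤ C) (t : ℝ≥0) :
    Tendsto (fun δ : ℝ≥0 => (δ : ℝ)⁻¹ • (h.fkOne hV hC (t + δ) - h.fkOne hV hC t)) (𝓝[>] 0)
      (𝓝 (h.fkOp hV hC t (potOp μ hV hC (Lp.const 2 μ 1)))) := by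
  refine (((h.fkOp hV hC t).continuous.tendsto _).comp (h.tendsto_fkOne_sub_one hV hC)).congr
    fun δ => ?_
  rw [Function.comp_apply, map_smul, map_sub, fkOne, ← fkOp_add]
  rfl

/-- `u(t)` lies in the domain of the generator and solves `A u = u' - V u`. -/
theorem tendsto_fkOne_generator (h : IsStationaryMarkov ℱ X Pr μ) (hV : Measurable V)
    (hC : ∀ x, |V x| ≤ C) (t : ℝ≥0) :
    Tendsto (fun δ : ℝ≥0 => (δ : ℝ)⁻¹ •
        ((h.J 0).adjoint (h.J δ (h.fkOne hV hC t)) - h.fkOne hV hC t)) (𝓝[>] 0)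
      (𝓝 (h.fkOp hV hC t (potOp μ hV hC (Lp.const 2 μ 1)) - potOp μ hV hC (h.fkOne hV hC t))) := by
  refine ((h.tendsto_fkOne_slope hV hC t).sub
    (h.tendsto_fkOp_sub_div hV hC (h.fkOne hV hC t))).congr fun δ => ?_
  rw [← smul_sub]
  congr 1
  rw [add_comm t δ, fkOne, fkOne, fkOp_add]
  abel

theorem continuous_fkOne (h : IsStationaryMarkov ℱ X Pr μ) (hV : Measurable V)
    (hC : ∀ x, |V x| ≤ C) : Continuous (h.fkOne hV hC) := by
  have hsmall : ∀ δ : ℝ≥0, (C : ℝ) * δ ≤ 1 →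
      ‖h.fkOne hV hC δ - Lp.const 2 μ 1‖ ≤ (C * δ) ^ 2 + C * δ := by
    intro δ hδ
    have h1 := h.norm_weightOp_sub_le hV hC 0 (by simpa using hδ) (Lp.const 2 Pr 1)
    have h2 := h.norm_mulOp_pathIntegral_le hV hC 0 δ (Lp.const 2 Pr 1)
    rw [zero_add] at h1 h2
    have hn : ‖(Lp.const 2 Pr 1 : Lp ℝ 2 Pr)‖ ≤ 1 := by
      refine (Lp.norm_const_le ..).trans ?_
      simp
    have hsplit : h.fkOne hV hC δ - Lp.const 2 μ 1 = (h.J 0).adjoint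
        ((h.weightOp hV hC 0 δ (Lp.const 2 Pr 1) - Lp.const 2 Pr 1
          - mulOp (h.memLp_top_pathIntegral hV hC 0 δ) (Lp.const 2 Pr 1))
        + mulOp (h.memLp_top_pathIntegral hV hC 0 δ) (Lp.const 2 Pr 1)) := by
      rw [sub_add_cancel, map_sub, h.adjoint_J_const, fkOne, h.fkOp_apply, h.J_const]
    rw [hsplit]
    refine (norm_adjoint_compOp_le _ _).trans ((norm_add_le _ _).trans (add_le_add
      (h1.trans ?_) (h2.trans ?_)))
    · exact mul_le_of_le_one_right (by positivity) hn
    · exact mul_le_of_le_one_right (by positivity) hn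
  have hstep : ∀ s δ : ℝ≥0, (C : ℝ) * δ ≤ 1 → ‖h.fkOne hV hC (s + δ) - h.fkOne hV hC s‖
      ≤ Real.exp (C * s) * ((C * δ) ^ 2 + C * δ) := by
    intro s δ hδ
    rw [fkOne, fkOne, fkOp_add, ← map_sub]
    exact (h.norm_fkOp_le hV hC s _).trans (by gcongr; exact hsmall δ hδ)
  have hdist : ∀ s t : ℝ≥0, (C : ℝ) * dist s t ≤ 1 → dist (h.fkOne hV hC s) (h.fkOne hV hC t)
      ≤ Real.exp (C * t) * ((C * dist s t) ^ 2 + C * dist s t) := by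
    intro s t hst
    rcases le_total s t with hle | hle
    · obtain ⟨δ, rfl⟩ := exists_add_of_le hle
      have hd : dist s (s + δ) = δ := by simp [NNReal.dist_eq]
      rw [hd] at hst ⊢
      rw [dist_comm, dist_eq_norm]
      refine (hstep s δ hst).trans ?_
      gcongr
    · obtain ⟨δ, rfl⟩ := exists_add_of_le hle
      have hd : dist (t + δ) t = δ := by simp [NNReal.dist_eq]
      rw [hd] at hst ⊢
      rw [dist_eq_norm]
      exact hstep t δ hst
  refine continuous_iff_continuousAt.2 fun t => ?_
  have hd : Continuous fun s : ℝ≥0 => dist s t := by fun_prop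
  have hd1 : Tendsto (fun s : ℝ≥0 => (C : ℝ) * dist s t) (𝓝 t) (𝓝 0) := by
    simpa using (hd.const_mul (C : ℝ)).tendsto t
  have hd2 : Tendsto (fun s : ℝ≥0 => Real.exp (C * t) * ((C * dist s t) ^ 2 + C * dist s t)) (𝓝 t)
      (𝓝 0) := by
    simpa using ((hd1.pow 2).add hd1).const_mul (Real.exp (C * t))
  refine tendsto_iff_dist_tendsto_zero.2 (squeeze_zero' (Eventually.of_forall fun _ => dist_nonneg)
    ?_ hd2)
  filter_upwards [hd1.eventually (ge_mem_nhds zero_lt_one)] with s hs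
  exact hdist s t hs

/-- The energy estimate: a bound `k` on the quadratic form of `A + V` over the domain of the
generator bounds the growth of the Feynman-Kac functional. -/
theorem integral_exp_pathIntegral_le (h : IsStationaryMarkov ℱ X Pr μ) (hV : Measurable V)
    (hC : ∀ x, |V x| ≤ C) {k : ℝ}
    (hk : ∀ g a : Lp ℝ 2 μ, Tendsto (fun δ : ℝ≥0 => (δ : ℝ)⁻¹ •
      ((h.J 0).adjoint (h.J δ g) - g)) (𝓝[>] 0) (𝓝 a) →
      inner ℝ a g + inner ℝ (potOp μ hV hC g) g ≤ k * ‖g‖ ^ 2) (T : ℝ≥0) :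
    ∫ ω, Real.exp (pathIntegral X V 0 T ω) ∂Pr ≤ Real.exp (k * T) := by
  set u : ℝ → Lp ℝ 2 μ := fun x => h.fkOne hV hC x.toNNReal with hu
  set v : ℝ → Lp ℝ 2 μ := fun x => h.fkOp hV hC x.toNNReal (potOp μ hV hC (Lp.const 2 μ 1)) with hv
  have hderiv : ∀ x, 0 ≤ x → HasDerivWithinAt u (v x) (Set.Ici x) x := by
    intro x hx
    rw [← hasDerivWithinAt_Ioi_iff_Ici, hasDerivWithinAt_iff_tendsto_slope' (by simp)]
    have hmap : Tendsto (fun y : ℝ => (y - x).toNNReal) (𝓝[>] x) (𝓝[>] 0) := by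
      refine tendsto_nhdsWithin_iff.2 ⟨?_, ?_⟩
      · have : Continuous fun y : ℝ => (y - x).toNNReal := by fun_prop
        simpa using (this.tendsto x).mono_left nhdsWithin_le_nhds
      · filter_upwards [self_mem_nhdsWithin] with y hy
        exact Real.toNNReal_pos.2 (sub_pos.2 hy)
    refine ((h.tendsto_fkOne_slope hV hC x.toNNReal).comp hmap).congr' ?_
    filter_upwards [self_mem_nhdsWithin] with y hy
    have hxy : 0 ≤ y - x := sub_nonneg.2 (le_of_lt hy)
    rw [Function.comp_apply, slope, Real.coe_toNNReal _ hxy, ← Real.toNNReal_add hx hxy,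
      add_sub_cancel, vsub_eq_sub]
  have henergy : ∀ x, 0 ≤ x → inner ℝ (u x) (v x) ≤ k * ‖u x‖ ^ 2 := by
    intro x _
    have h1 := hk _ _ (h.tendsto_fkOne_generator hV hC x.toNNReal)
    rw [← inner_add_left, sub_add_cancel] at h1
    rw [real_inner_comm]
    exact h1
  have hn : ‖(Lp.const 2 μ 1 : Lp ℝ 2 μ)‖ ≤ 1 := by
    refine (Lp.norm_const_le ..).trans ?_
    simp
  have hu0 : u 0 = Lp.const 2 μ 1 := by
    simp only [hu, Real.toNNReal_zero, fkOne, fkOp_zero]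
  have huT : ‖u T‖ ≤ Real.exp (k * T) * ‖u 0‖ :=
    norm_le_exp_mul_of_inner_deriv_right_le
      ((h.continuous_fkOne hV hC).comp continuous_real_toNNReal) hderiv henergy T.2
  rw [hu0] at huT
  have hval : ∫ ω, Real.exp (pathIntegral X V 0 T ω) ∂Pr = inner ℝ (Lp.const 2 μ 1) (u T) := by
    simp only [hu, Real.toNNReal_coe]
    rw [fkOne, h.fkOp_apply, ContinuousLinearMap.adjoint_inner_right, h.J_const, h.J_const,
      real_inner_Lp_eq_integral_mul]
    refine integral_congr_ae ?_
    filter_upwards [coeFn_mulOp (h.memLp_top_exp hV hC 0 T) (Lp.const 2 Pr 1),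
      Lp.coeFn_const (p := 2) (μ := Pr) (1 : ℝ)] with ω h1 h2
    rw [h1, h2]
    simp
  rw [hval]
  calc _ ≤ ‖(Lp.const 2 μ 1 : Lp ℝ 2 μ)‖ * ‖u T‖ := real_inner_le_norm _ _
    _ ≤ 1 * (Real.exp (k * T) * 1) := by
      gcongr
      exact huT.trans (by gcongr)
    _ = _ := by ring

end IsStationaryMarkov

/-! ### The variational formula and the uncertainty bound -/

/-- The Donsker-Varadhan inequality: relative entropy to the exponentially tilted measure is
nonnegative. -/
theorem integral_le_toReal_klDiv_add_log {α : Type*} [MeasurableSpace α] {Q P : Measure α}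
    [IsProbabilityMeasure Q] [IsProbabilityMeasure P] (hQP : InformationTheory.klDiv Q P ≠ ∞)
    {F : α → ℝ} (hF : Measurable F) {B : ℝ} (hB : ∀ x, |F x| ≤ B) :
    ∫ x, F x ∂Q ≤ (InformationTheory.klDiv Q P).toReal + Real.log (∫ x, Real.exp (F x) ∂P) := by
  obtain ⟨hac, hint⟩ := InformationTheory.klDiv_ne_top_iff.1 hQP
  have hFQ : Integrable F Q := Integrable.of_bound hF.aestronglyMeasurable B (ae_of_all _ hB)
  have hexp : Integrable (fun x => Real.exp (F x)) P :=
    Integrable.of_bound hF.exp.aestronglyMeasurable (Real.exp B) (ae_of_all _ fun x => by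
      rw [Real.norm_eq_abs, Real.abs_exp]
      exact Real.exp_le_exp.2 ((le_abs_self _).trans (hB x)))
  have : IsProbabilityMeasure (P.tilted F) := isProbabilityMeasure_tilted hexp
  have h1 := integral_llr_tilted_right hac hFQ hexp hint
  have h2 := InformationTheory.integral_llr_add_sub_measure_univ_nonneg
    (hac.trans (absolutelyContinuous_tilted hexp)) (integrable_llr_tilted_right hac hFQ hint hexp)
  have h3 := InformationTheory.toReal_klDiv_of_measure_eq hac (by simp : Q Set.univ = P Set.univ)
  simp only [probReal_univ] at h2
  linarith

section

variable {E Ω : Type*} [TopologicalSpace E] [PolishSpace E] [MeasurableSpace E]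
  [BorelSpace E] [mΩ : MeasurableSpace Ω] {ℱ : Filtration ℝ≥0 mΩ} {X : ℝ≥0 → Ω → E}
  {p : ℝ≥0 → E → Measure E} {P P' : E → Measure Ω} {μ μ' : Measure E} [IsProbabilityMeasure μ]
  [IsProbabilityMeasure μ'] {V : E → ℝ} {C : ℝ≥0}

/-- Convergence of the difference quotients of `J₀† J_t` in `L²(μ)` is what `HasGenerator` asks. -/
theorem IsCadlagMarkovFamily.hasGenerator (hP : IsCadlagMarkovFamily ℱ X p P)
    (hμ : IsInvariantMeasure p μ) {g a : Lp ℝ 2 μ}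
    (ha : Tendsto (fun δ : ℝ≥0 => (δ : ℝ)⁻¹ •
      (((hP.isStationaryMarkov hμ).J 0).adjoint ((hP.isStationaryMarkov hμ).J δ g) - g))
      (𝓝[>] 0) (𝓝 a)) : HasGenerator p μ g a := by
  refine (tendsto_iff_edist_tendsto_0.1 ha).congr fun δ => ?_
  rw [Lp.edist_def]
  refine eLpNorm_congr_ae ?_
  filter_upwards [hP.adjoint_compOp_ae_eq hμ δ g,
    Lp.coeFn_smul (δ : ℝ)⁻¹ (((hP.isStationaryMarkov hμ).J 0).adjoint
      ((hP.isStationaryMarkov hμ).J δ g) - g),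
    Lp.coeFn_sub (((hP.isStationaryMarkov hμ).J 0).adjoint ((hP.isStationaryMarkov hμ).J δ g)) g]
    with x h1 h2 h3
  rw [Pi.sub_apply, h2, Pi.smul_apply, h3, Pi.sub_apply, h1, smul_eq_mul, div_eq_inv_mul]

omit [PolishSpace E] [BorelSpace E] [TopologicalSpace E] [IsProbabilityMeasure μ] in
theorem inner_potOp (hV : Measurable V) (hC : ∀ x, |V x| ≤ C) (g : Lp ℝ 2 μ) :
    inner ℝ (IsStationaryMarkov.potOp μ hV hC g) g = ∫ x, V x * (g x) ^ 2 ∂μ := by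
  rw [real_inner_Lp_eq_integral_mul]
  refine integral_congr_ae ?_
  filter_upwards [coeFn_mulOp (memLp_top_of_bound hV.aestronglyMeasurable C
    (ae_of_all μ fun x => hC x)) g] with x hx
  rw [hx]
  ring

/-- The constant function `1` is in the domain of the generator, so `κ(V)` is a supremum over a
nonempty set. -/
theorem IsCadlagMarkovFamily.kappa_ne_bot (hP : IsCadlagMarkovFamily ℱ X p P)
    (hμ : IsInvariantMeasure p μ) : kappa p μ V ≠ ⊥ := by
  have := hP.isProbabilityMeasure_law μ
  have hgen : HasGenerator p μ (Lp.const 2 μ 1) 0 := by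
    refine hP.hasGenerator hμ (tendsto_const_nhds.congr fun δ => ?_)
    rw [IsStationaryMarkov.J_const, IsStationaryMarkov.adjoint_J_const, sub_self, smul_zero]
  have hnorm : ‖(Lp.const 2 μ 1 : Lp ℝ 2 μ)‖ = 1 := by
    rw [Lp.norm_const (p := 2) (μ := μ) (c := (1 : ℝ)) two_ne_zero]
    simp
  exact ne_bot_of_le_ne_bot (EReal.coe_ne_bot _) (le_sSup ⟨_, _, hgen, hnorm, rfl⟩)

/-- By homogeneity, `κ(V)` bounds the quadratic form of `A + V` on the whole domain. -/
theorem IsCadlagMarkovFamily.inner_add_le_of_kappa_eq (hP : IsCadlagMarkovFamily ℱ X p P)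
    (hμ : IsInvariantMeasure p μ) (hV : Measurable V) (hC : ∀ x, |V x| ≤ C) {k : ℝ}
    (hk : kappa p μ V = k) (g a : Lp ℝ 2 μ) (ha : Tendsto (fun δ : ℝ≥0 => (δ : ℝ)⁻¹ •
      (((hP.isStationaryMarkov hμ).J 0).adjoint ((hP.isStationaryMarkov hμ).J δ g) - g))
      (𝓝[>] 0) (𝓝 a)) :
    inner ℝ a g + inner ℝ (IsStationaryMarkov.potOp μ hV hC g) g ≤ k * ‖g‖ ^ 2 := by
  rcases eq_or_ne g 0 with rfl | hg
  · simp
  have hg' : 0 < ‖g‖ := norm_pos_iff.2 hg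
  have hgen : HasGenerator p μ (‖g‖⁻¹ • g) (‖g‖⁻¹ • a) := by
    refine hP.hasGenerator hμ ((ha.const_smul ‖g‖⁻¹).congr fun δ => ?_)
    rw [map_smul, map_smul, ← smul_sub, smul_comm]
  have hle : ((inner ℝ (‖g‖⁻¹ • a) (‖g‖⁻¹ • g)
      + ∫ x, V x * ((‖g‖⁻¹ • g : Lp ℝ 2 μ) x) ^ 2 ∂μ : ℝ) : EReal) ≤ k := by
    rw [← hk]
    exact le_sSup ⟨_, _, hgen, by rw [norm_smul, norm_inv, norm_norm, inv_mul_cancel₀ hg'.ne'], rfl⟩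
  rw [EReal.coe_le_coe_iff, ← inner_potOp hV hC, map_smul, real_inner_smul_left,
    real_inner_smul_left, real_inner_smul_right, real_inner_smul_right, ← mul_add, ← mul_add,
    ← mul_assoc, ← mul_inv, inv_mul_le_iff₀ (by positivity)] at hle
  linarith

/-- The bound for a potential `V` that need not be centred. -/
theorem IsCadlagMarkovFamily.integral_pathIntegral_le (hP : IsCadlagMarkovFamily ℱ X p P)
    (hP' : IsProcessFamily (X 0) P') (hμ : IsInvariantMeasure p μ) (hV : Measurable V)
    (hC : ∀ x, |V x| ≤ C) {T : ℝ≥0} (hT : 0 < T) :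
    (((∫ ω, pathIntegral X V 0 T ω ∂(hP'.law μ')) / T : ℝ) : EReal)
      ≤ kappa p μ V + (relEntropyRate ℱ (hP'.law μ') (hP.law μ) T : EReal) := by
  have := hP.isProbabilityMeasure_law μ
  have := hP'.isProbabilityMeasure_law μ'
  have hS := hP.isStationaryMarkov hμ
  have hbot := hP.kappa_ne_bot (V := V) hμ
  have hT' : (0 : ℝ) < T := hT
  -- Excluding `κ(V) = ⊥` matters here, since `⊥ + ⊤ = ⊥` in `EReal`.
  rcases eq_or_ne (relEntropyRate ℱ (hP'.law μ') (hP.law μ) T) ∞ with hη | hη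
  · rw [hη, EReal.coe_ennreal_top, EReal.add_top_of_ne_bot hbot]
    exact le_top
  induction hκ : kappa p μ V with
  | bot => exact absurd hκ hbot
  | top =>
    rw [EReal.top_add_of_ne_bot (EReal.coe_ennreal_ne_bot _)]
    exact le_top
  | coe k =>
    have hkl : InformationTheory.klDiv ((hP'.law μ').trim (ℱ.le T)) ((hP.law μ).trim (ℱ.le T))
        ≠ ∞ := fun h0 => hη (by
      rw [relEntropyRate, h0]
      exact ENNReal.top_div_of_ne_top ENNReal.coe_ne_top)
    have hm := hS.measurable_pathIntegral_filtration hV (zero_le (a := T))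
    have : IsProbabilityMeasure ((hP.law μ).trim (ℱ.le T)) :=
      ⟨by rw [trim_measurableSet_eq _ MeasurableSet.univ, measure_univ]⟩
    have : IsProbabilityMeasure ((hP'.law μ').trim (ℱ.le T)) :=
      ⟨by rw [trim_measurableSet_eq _ MeasurableSet.univ, measure_univ]⟩
    have hDV := @integral_le_toReal_klDiv_add_log Ω (ℱ T) _ _ _ _ hkl _ hm _
      (abs_pathIntegral_le hC 0 T)
    rw [← integral_trim (ℱ.le T) hm.stronglyMeasurable,
      ← integral_trim (ℱ.le T) hm.exp.stronglyMeasurable] at hDV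
    have hFK := hS.integral_exp_pathIntegral_le hV hC
      (hP.inner_add_le_of_kappa_eq hμ hV hC hκ) T
    have hpos : 0 < ∫ ω, Real.exp (pathIntegral X V 0 T ω) ∂(hP.law μ) :=
      integral_exp_pos ((hS.memLp_top_exp hV hC 0 T).integrable le_top)
    have hlog := Real.log_le_log hpos hFK
    rw [Real.log_exp] at hlog
    have hη' : (relEntropyRate ℱ (hP'.law μ') (hP.law μ) T : EReal)
        = ((InformationTheory.klDiv ((hP'.law μ').trim (ℱ.le T))
          ((hP.law μ).trim (ℱ.le T))).toReal / T : ℝ) := by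
      rw [← EReal.coe_toReal (EReal.coe_ennreal_eq_top_iff.not.2 hη) (EReal.coe_ennreal_ne_bot _),
        EReal.toReal_coe_ennreal, relEntropyRate, ENNReal.toReal_div, ENNReal.coe_toReal]
    rw [hη', ← EReal.coe_add, EReal.coe_le_coe_iff, div_le_iff₀ hT', add_mul,
      div_mul_cancel₀ _ hT'.ne']
    linarith

/-- The bound for the centred potential `b (f - m)`, where `b` may have either sign. -/
theorem IsCadlagMarkovFamily.mul_integral_timeAverage_sub_le (hP : IsCadlagMarkovFamily ℱ X p P)
    (hP' : IsProcessFamily (X 0) P') (hμ : IsInvariantMeasure p μ) {f : E → ℝ} (hf : Measurable f)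
    (hC : ∀ x, |f x| ≤ C) {T : ℝ≥0} (hT : 0 < T) (b m : ℝ) :
    ((b * ((∫ ω, timeAverage X f T ω ∂(hP'.law μ')) - m) : ℝ) : EReal)
      ≤ kappa p μ (fun x => b * (f x - m))
        + (relEntropyRate ℱ (hP'.law μ') (hP.law μ) T : EReal) := by
  have := hP.isProbabilityMeasure_law μ
  have := hP'.isProbabilityMeasure_law μ'
  have hS := hP.isStationaryMarkov hμ
  have hT' : (0 : ℝ) < T := hT
  have hbd : ∀ x, |b * (f x - m)| ≤ (⟨|b| * (C + |m|), by positivity⟩ : ℝ≥0) := fun x => by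
    rw [abs_mul]
    exact mul_le_mul_of_nonneg_left ((abs_sub _ _).trans (add_le_add (hC x) le_rfl)) (abs_nonneg _)
  refine le_trans (le_of_eq ?_)
    (hP.integral_pathIntegral_le hP' (μ' := μ') hμ ((hf.sub_const m).const_mul b) hbd hT)
  congr 1
  have hpath : ∀ ω, pathIntegral X (fun x => b * (f x - m)) 0 T ω
      = b * (pathIntegral X f 0 T ω - T * m) := fun ω => by
    rw [pathIntegral, pathIntegral, intervalIntegral.integral_const_mul,
      intervalIntegral.integral_sub
        (intervalIntegrable_comp_path hP.measurable hS.rightCont hf hC _ _ ω)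
        intervalIntegrable_const, intervalIntegral.integral_const]
    simp
  have havg : ∀ ω, timeAverage X f T ω = (1 / (T : ℝ)) * pathIntegral X f 0 T ω := fun ω => rfl
  have hint : Integrable (pathIntegral X f 0 T) (hP'.law μ') :=
    Integrable.of_bound (hS.measurable_pathIntegral_ambient hf 0 T).aestronglyMeasurable _
      (ae_of_all _ (abs_pathIntegral_le hC 0 T))
  simp only [hpath, havg]
  rw [integral_const_mul, integral_const_mul, integral_sub hint (integrable_const _),
    integral_const, probReal_univ]
  simp only [smul_eq_mul, one_mul]
  field_simp

end

theorem mainTheorem1 {E Ω : Type*} [TopologicalSpace E] [PolishSpace E] [MeasurableSpace E]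
    [BorelSpace E] [mΩ : MeasurableSpace Ω] (ℱ : Filtration ℝ≥0 mΩ) (X : ℝ≥0 → Ω → E)
    (p : ℝ≥0 → E → Measure E) (P P' : E → Measure Ω)
    (hP : IsCadlagMarkovFamily ℱ X p P) (hP' : IsProcessFamily (X 0) P')
    (μ μ' : Measure E) [IsProbabilityMeasure μ] [IsProbabilityMeasure μ']
    (hμ : IsInvariantMeasure p μ)
    (f : E → ℝ) (hf : Measurable f) (hfb : ∃ C : ℝ, ∀ x, |f x| ≤ C)
    (T : ℝ≥0) (hT : 0 < T) :
    (((∫ ω, timeAverage X f T ω ∂(hP'.law μ')) - ∫ x, f x ∂μ : ℝ) : EReal)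
        ≤ xiBound (fun c => kappa p μ fun x => c * (f x - ∫ y, f y ∂μ))
            (relEntropyRate ℱ (hP'.law μ') (hP.law μ) T) ∧
      ((-((∫ ω, timeAverage X f T ω ∂(hP'.law μ')) - ∫ x, f x ∂μ) : ℝ) : EReal)
        ≤ xiBound (fun c => kappa p μ fun x => -c * (f x - ∫ y, f y ∂μ))
            (relEntropyRate ℱ (hP'.law μ') (hP.law μ) T) := by
  obtain ⟨C, hC⟩ := hfb
  have hC' : ∀ x, |f x| ≤ C.toNNReal := fun x => (hC x).trans (Real.le_coe_toNNReal C)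
  have key := hP.mul_integral_timeAverage_sub_le hP' (μ' := μ') hμ hf hC' hT
  refine ⟨le_iInf₂ fun c hc => ?_, le_iInf₂ fun c hc => ?_⟩
  · rw [EReal.le_div_iff_mul_le (EReal.coe_pos.2 hc) (EReal.coe_ne_top c), ← EReal.coe_mul, mul_comm]
    exact key c _
  · rw [EReal.le_div_iff_mul_le (EReal.coe_pos.2 hc) (EReal.coe_ne_top c), ← EReal.coe_mul,
      mul_comm, mul_neg, ← neg_mul]
    exact key (-c) _
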